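/- Fix a local dimension $d\ge 1$. Let $(G_n)_{n\in\mathbb N}$, $G_n=(V_n,E_n)$, be a sequence of finite connected simple graphs with $V_n\subseteq V_{n+1}$ for all $n$ and $|V_n|\to\infty$. For $p\in[0,1]$ let $$\rho(p)=p\,|\phi^+\rangle\langle\phi^+|+\frac{1-p}{d^2}\,\mathbb 1,\qquad |\phi^+\rangle=\frac1{\sqrt d}\sum_{i=1}^d|ii\rangle,$$ be the isotropic state on $\mathbb C^d\otimes\mathbb C^d$, and let $\sigma(G_n,p)=\bigotimes_{e\in E_n}\rho_e(p)$ be the isotropic network state, in which the two qudits of the copy $\rho_e(p)$ are held by the two end vertices of $e$; each vertex is a party and holds one qudit for each edge incident to it. An LOCC map is one implemented by local operations of the parties and finitely many rounds of classical communication. The fidelity is $F(\rho,\sigma)=\bigl(\operatorname{tr}\sqrt{\sqrt\rho\,\sigma\sqrt\rho}\bigr)^2$. Suppose that the minimum degrees satisfy $\delta_{\min}(G_n)=\Omega(|V_n|)$, i.e. there is $c>0$ with $\delta_{\min}(G_n)\ge c|V_n|$ for all sufficiently large $n$, and that the edge-connectivity $\lambda(G_n)$ (the least number of edges whose removal disconnects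 $G_n$) tends to infinity. Then $(G_n)$ has partial distillability: there exists $p_0<1$, depending only on the sequence and $d$, such that for every $m\in\mathbb N$, every set $V_0\subseteq\bigcup_n V_n$ of $m$ parties and every pure state $\psi$ on $\bigotimes_{v\in V_0}\mathbb C^d$, there are LOCC maps $\Lambda_{n,p}$ (for all $n$ with $V_0\subseteq V_n$) from states of the network $G_n$ to states on $\bigotimes_{v\in V_0}\mathbb C^d$, where party $v\in V_0$ holds the $v$-th qudit, such that $$\lim_{n\to\infty}F\bigl(\Lambda_{n,p}(\sigma(G_n,p)),\psi\bigr)=1\qquad\text{for all } p\in(p_0,1]\cap[0,1].$$ -/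

import Mathlib

open Filter Topology
open scoped ComplexOrder MatrixOrder Matrix

universe u

/-! ### Graph sequences -/

/-- The minimum number of edges whose removal disconnects `G`. -/
noncomputable def edgeConnectivity {V : Type u} (G : SimpleGraph V) : ℕ :=
  sInf {k : ℕ | ∃ F : Finset (Sym2 V),
    (F : Set (Sym2 V)) ⊆ G.edgeSet ∧ F.card = k ∧ ¬ (G.deleteEdges (F : Set (Sym2 V))).Connected}

open Classical in
/-- The minimum degree of a finite graph. -/
noncomputable def minDeg {V : Type u} [Fintype V] (G : SimpleGraph V) : ℕ := G.minDegree

/-- A sequence of finite connected simple graphs with nested vertex sets (inside an ambient type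
of vertices `α`) whose orders tend to infinity. -/
structure GraphSequence (α : Type u) where
  verts : ℕ → Finset α
  graph : ∀ n, SimpleGraph (verts n)
  connected : ∀ n, (graph n).Connected
  verts_subset_succ : ∀ n, verts n ⊆ verts (n + 1)
  order_tendsto : Tendsto (fun n => (verts n).card) atTop atTop

/-! ### States and fidelity

Operators on a Hilbert space with orthonormal basis indexed by a finite type `ι` are written as
matrices `Matrix ι ι ℂ`. -/

/-- A pure state: the rank-one projector onto a unit vector. -/
def IsPureState {ι : Type u} [Fintype ι] (ρ : Matrix ι ι ℂ) : Prop :=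
  ∃ φ : ι → ℂ, ∑ i, ‖φ i‖ ^ 2 = 1 ∧ ρ = Matrix.vecMulVec φ (star φ)

/-- The fidelity `(tr √(√ρ σ √ρ))²`. -/
noncomputable def fidelity {ι : Type u} [Fintype ι] [DecidableEq ι] (ρ σ : Matrix ι ι ℂ) : ℝ :=
  (CFC.sqrt (CFC.sqrt ρ * σ * CFC.sqrt ρ)).trace.re ^ 2

/-- The vector `(1/√d) ∑ᵢ |ii⟩`. -/
noncomputable def maxEntangledVec (d : ℕ) : Fin d × Fin d → ℂ :=
  fun i => if i.1 = i.2 then ((1 / Real.sqrt d : ℝ) : ℂ) else 0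

/-- The isotropic state of visibility `p` and local dimension `d`. -/
noncomputable def isotropic (d : ℕ) (p : ℝ) : Matrix (Fin d × Fin d) (Fin d × Fin d) ℂ :=
  (p : ℂ) • Matrix.vecMulVec (maxEntangledVec d) (star (maxEntangledVec d)) +
    (((1 - p) / (d : ℝ) ^ 2 : ℝ) : ℂ) • 1

/-- The isotropic state does not depend on the order of the two subsystems. -/
theorem isotropic_swap (d : ℕ) (p : ℝ) (i j : Fin d × Fin d) :
    isotropic d p i.swap j.swap = isotropic d p i j := by
  simp [isotropic, maxEntangledVec, Matrix.vecMulVec_apply, Matrix.one_apply, eq_comm,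
    Prod.swap_inj]

/-! ### Isotropic network states -/

/-- Basis of the Hilbert space of party `v`: one qudit for each edge at `v`. -/
abbrev PartyIdx {V : Type u} (G : SimpleGraph V) (d : ℕ) (v : V) : Type u :=
  G.incidenceSet v → Fin d

/-- Basis of the Hilbert space of the whole network, the tensor product over all parties. -/
abbrev NetIdx {V : Type u} (G : SimpleGraph V) (d : ℕ) : Type u :=
  ∀ v : V, PartyIdx G d v

/-- The basis label of the two qudits belonging to the edge `e`. The edge is oriented by an
arbitrary choice, which is immaterial by `isotropic_swap`. -/
noncomputable def edgeIdx {V : Type u} (G : SimpleGraph V) (d : ℕ) (x : NetIdx G d)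
    (e : G.edgeSet) : Fin d × Fin d :=
  (x (Quot.out e.1).1 ⟨e.1, e.2, Sym2.out_fst_mem e.1⟩,
    x (Quot.out e.1).2 ⟨e.1, e.2, Sym2.out_snd_mem e.1⟩)

open Classical in
/-- The isotropic network state: the tensor product over all edges of isotropic states. -/
noncomputable def networkState {V : Type u} [Fintype V] (G : SimpleGraph V) (d : ℕ) (p : ℝ) :
    Matrix (NetIdx G d) (NetIdx G d) ℂ :=
  Matrix.of fun x y => ∏ e : G.edgeSet, isotropic d p (edgeIdx G d x e) (edgeIdx G d y e)

/-! ### LOCC maps -/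

/-- The tensor product `⨂ᵥ Aᵥ` of local operators. -/
def tensorOp {P : Type u} [Fintype P] {I I' : P → Type u} (A : ∀ v, Matrix (I' v) (I v) ℂ) :
    Matrix (∀ v, I' v) (∀ v, I v) ℂ :=
  Matrix.of fun x y => ∏ v, A v (x v) (y v)

/-- Maps implementable by local operations and (finitely many rounds of) classical communication
among the parties `P`, from local spaces with bases `I v` to local spaces with bases `O v`.

In one round a party `k` performs a measurement on its system with Kraus operators `A j k` and
announces the outcome `j`. The other parties may apply local isometries `A j v` depending on `j`,
so that the local spaces are now those with bases `I' j v`, and the protocol goes on in a way that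
depends on `j`. Outcomes are discarded at the end, so that the resulting maps
are summed. General local channels and instruments arise by ignoring (part of) an outcome. -/
inductive IsLOCC {P : Type u} [Fintype P] [DecidableEq P] {O : P → Type u}
    [∀ v, Fintype (O v)] [∀ v, DecidableEq (O v)] :
    (I : P → Type u) → [∀ v, Fintype (I v)] → [∀ v, DecidableEq (I v)] →
    (Matrix (∀ v, I v) (∀ v, I v) ℂ → Matrix (∀ v, O v) (∀ v, O v) ℂ) → Prop
  | done : IsLOCC O (fun ρ => ρ)
  | round {I : P → Type u} [∀ v, Fintype (I v)] [∀ v, DecidableEq (I v)]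
      (k : P) {J : Type} [Fintype J] (I' : J → P → Type u)
      [∀ j v, Fintype (I' j v)] [∀ j v, DecidableEq (I' j v)]
      (A : ∀ j v, Matrix (I' j v) (I v) ℂ)
      (measurement : ∑ j, (A j k)ᴴ * A j k = 1)
      (isometry : ∀ j v, v ≠ k → (A j v)ᴴ * A j v = 1)
      (Λ : ∀ j, Matrix (∀ v, I' j v) (∀ v, I' j v) ℂ → Matrix (∀ v, O v) (∀ v, O v) ℂ)
      (rest : ∀ j, IsLOCC (I' j) (Λ j)) :
      IsLOCC I (fun ρ => ∑ j, Λ j (tensorOp (A j) * ρ * (tensorOp (A j))ᴴ))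

/-- Basis of the output space of party `v` for targets on `V₀`: one qudit if `v ∈ V₀`, and the
trivial one-dimensional space otherwise. -/
abbrev OutIdx {α : Type u} (V₀ : Finset α) (d : ℕ) (v : α) : Type u :=
  {w : V₀ // (w : α) = v} → Fin d

/-- The output space of all parties is the target space with one qudit for each element of `V₀`. -/
def outEquiv {α : Type u} {V V₀ : Finset α} (h : V₀ ⊆ V) (d : ℕ) :
    (∀ v : V, OutIdx V₀ d (v : α)) ≃ (V₀ → Fin d) where
  toFun f w := f ⟨w, h w.2⟩ ⟨w, rfl⟩
  invFun g _ w := g w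
  left_inv f := by
    funext v w
    obtain ⟨w, hw⟩ := w
    obtain rfl : v = ⟨w, h w.2⟩ := Subtype.ext hw.symm
    rfl
  right_inv _ := rfl

open Classical in
/-- `Λ` is an LOCC map from the network on `G` (all vertices being distinct parties) to states with
one qudit at each party in `V₀`. -/
def IsNetworkLOCC {α : Type u} {V : Finset α} (G : SimpleGraph V) (d : ℕ) {V₀ : Finset α}
    (h : V₀ ⊆ V)
    (Λ : Matrix (NetIdx G d) (NetIdx G d) ℂ → Matrix (V₀ → Fin d) (V₀ → Fin d) ℂ) : Prop :=
  ∃ Γ : Matrix (NetIdx G d) (NetIdx G d) ℂ →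
      Matrix (∀ v : V, OutIdx V₀ d (v : α)) (∀ v : V, OutIdx V₀ d (v : α)) ℂ,
    IsLOCC (PartyIdx G d) Γ ∧ ∀ ρ, Λ ρ = Matrix.reindex (outEquiv h d) (outEquiv h d) (Γ ρ)

/-! ### Partial distillability -/

open Classical in
/-- Partial distillability for local dimension `d`. For a set `V₀` of parties only the indices `n`
with `V₀ ⊆ Vₙ` (all sufficiently large ones) are relevant. -/
def HasPartialDistillability {α : Type u} (S : GraphSequence α) (d : ℕ) : Prop :=
  ∃ p₀ : ℝ, p₀ < 1 ∧
    ∀ (m : ℕ) (V₀ : Finset α), V₀.card = m → (∃ n, V₀ ⊆ S.verts n) →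
    ∀ ψ : Matrix (V₀ → Fin d) (V₀ → Fin d) ℂ, IsPureState ψ →
      ∃ Λ : ∀ n : ℕ, ℝ → Matrix (NetIdx (S.graph n) d) (NetIdx (S.graph n) d) ℂ →
          Matrix (V₀ → Fin d) (V₀ → Fin d) ℂ,
        (∀ n p (h : V₀ ⊆ S.verts n), IsNetworkLOCC (S.graph n) d h (Λ n p)) ∧
        ∀ p : ℝ, 0 ≤ p → p ≤ 1 → p₀ < p →
          Tendsto (fun n => fidelity (Λ n p (networkState (S.graph n) d p)) ψ) atTop (𝓝 1)

set_option linter.unusedSectionVars false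

/-! ### Tensor products of local operators -/

section TensorOp

variable {P : Type u} [Fintype P]

theorem tensorOp_apply {I I' : P → Type u} (A : ∀ v, Matrix (I' v) (I v) ℂ) (x y) :
    tensorOp A x y = ∏ v, A v (x v) (y v) := rfl

theorem tensorOp_mul [DecidableEq P] {I I' I'' : P → Type u} [∀ v, Fintype (I' v)]
    (A : ∀ v, Matrix (I'' v) (I' v) ℂ) (B : ∀ v, Matrix (I' v) (I v) ℂ) :
    tensorOp A * tensorOp B = tensorOp (fun v => A v * B v) := by
  ext x y
  simp only [Matrix.mul_apply, tensorOp_apply, ← Finset.prod_mul_distrib]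
  rw [Fintype.prod_sum]

theorem tensorOp_conjTranspose {I I' : P → Type u} (A : ∀ v, Matrix (I' v) (I v) ℂ) :
    (tensorOp A)ᴴ = tensorOp (fun v => (A v)ᴴ) := by
  ext x y
  simp [Matrix.conjTranspose_apply, tensorOp_apply]

theorem tensorOp_one [DecidableEq P] {I : P → Type u} [∀ v, DecidableEq (I v)] :
    tensorOp (fun v => (1 : Matrix (I v) (I v) ℂ)) = 1 := by
  ext x y
  rw [tensorOp_apply, Matrix.one_apply]
  split_ifs with h
  · subst h
    simp
  · obtain ⟨v, hv⟩ := Function.ne_iff.1 h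
    exact Finset.prod_eq_zero (Finset.mem_univ v) (Matrix.one_apply_ne hv)

theorem tensorOp_update_sum [DecidableEq P] {I : P → Type u} {J : Type*} [Fintype J] (k : P)
    (A : J → ∀ v, Matrix (I v) (I v) ℂ) (B : ∀ v, Matrix (I v) (I v) ℂ)
    (hk : ∑ j, A j k = B k) (h : ∀ j v, v ≠ k → A j v = B v) :
    ∑ j, tensorOp (A j) = tensorOp B := by
  ext x y
  simp only [Matrix.sum_apply, tensorOp_apply]
  rw [← Finset.mul_prod_erase _ _ (Finset.mem_univ k), ← hk, Matrix.sum_apply, Finset.sum_mul]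
  refine Finset.sum_congr rfl fun j _ => ?_
  rw [← Finset.mul_prod_erase _ _ (Finset.mem_univ k)]
  congr 1
  exact Finset.prod_congr rfl fun v hv => by rw [h j v (Finset.ne_of_mem_erase hv)]

end TensorOp

/-! ### Basic properties of LOCC maps -/

section LOCC

variable {P : Type u} [Fintype P] [DecidableEq P] {O : P → Type u}
  [∀ v, Fintype (O v)] [∀ v, DecidableEq (O v)]

/-- An LOCC map has a Kraus representation. -/
theorem IsLOCC.exists_kraus {I : P → Type u} [∀ v, Fintype (I v)] [∀ v, DecidableEq (I v)]
    {Λ : Matrix (∀ v, I v) (∀ v, I v) ℂ → Matrix (∀ v, O v) (∀ v, O v) ℂ} (h : IsLOCC I Λ) :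
    ∃ (ι : Type) (_ : Fintype ι) (K : ι → Matrix (∀ v, O v) (∀ v, I v) ℂ),
      (∀ ρ, Λ ρ = ∑ i, K i * ρ * (K i)ᴴ) ∧ ∑ i, (K i)ᴴ * K i = 1 := by
  induction h with
  | done => exact ⟨Unit, inferInstance, fun _ => 1, by simp, by simp⟩
  | @round I _ _ k J _ I' _ _ A measurement isometry Λ rest ih =>
    choose ι hι K hK hK1 using ih
    refine ⟨Σ j, ι j, inferInstance, fun s => K s.1 s.2 * tensorOp (A s.1), ?_, ?_⟩
    · intro ρ
      simp only [hK, Fintype.sum_sigma, Matrix.conjTranspose_mul, Matrix.mul_assoc]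
    · rw [Fintype.sum_sigma]
      have : ∀ j, ∑ i, (K j i * tensorOp (A j))ᴴ * (K j i * tensorOp (A j))
          = (tensorOp (A j))ᴴ * tensorOp (A j) := by
        intro j
        have h2 : ∀ i, (K j i * tensorOp (A j))ᴴ * (K j i * tensorOp (A j))
            = (tensorOp (A j))ᴴ * ((K j i)ᴴ * K j i) * tensorOp (A j) := by
          intro i
          simp only [Matrix.conjTranspose_mul, Matrix.mul_assoc]
        simp only [h2]
        rw [← Matrix.sum_mul, ← Matrix.mul_sum, hK1, Matrix.mul_one]
      simp only [this]
      simp only [tensorOp_conjTranspose, tensorOp_mul]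
      rw [← tensorOp_one]
      exact tensorOp_update_sum k _ _ measurement isometry

/-- There is an LOCC protocol which sends every (unnormalised) pure state in `S` to a multiple of
the pure state `ψ`. -/
def Distills (ψ : (∀ v, O v) → ℂ) (I : P → Type u) [∀ v, Fintype (I v)] [∀ v, DecidableEq (I v)]
    (S : Set ((∀ v, I v) → ℂ)) : Prop :=
  ∃ Λ : Matrix (∀ v, I v) (∀ v, I v) ℂ → Matrix (∀ v, O v) (∀ v, O v) ℂ, IsLOCC I Λ ∧
    ∀ Φ ∈ S, ∃ c : ℂ, Λ (Matrix.vecMulVec Φ (star Φ)) = c • Matrix.vecMulVec ψ (star ψ)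

theorem Matrix.conj_vecMulVec_star {m n : Type*} [Fintype n] (A : Matrix m n ℂ) (Φ : n → ℂ) :
    A * Matrix.vecMulVec Φ (star Φ) * Aᴴ = Matrix.vecMulVec (A *ᵥ Φ) (star (A *ᵥ Φ)) := by
  rw [Matrix.mul_vecMulVec, Matrix.vecMulVec_mul, Matrix.star_mulVec]

variable {ψ : (∀ v, O v) → ℂ} {I : P → Type u} [∀ v, Fintype (I v)] [∀ v, DecidableEq (I v)]

theorem Distills.mono {S S' : Set ((∀ v, I v) → ℂ)} (h : Distills ψ I S') (hS : S ⊆ S') :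
    Distills ψ I S := by
  obtain ⟨Λ, h1, h2⟩ := h
  exact ⟨Λ, h1, fun Φ hΦ => h2 Φ (hS hΦ)⟩

theorem Distills.done {S : Set ((∀ v, O v) → ℂ)} (hS : ∀ Φ ∈ S, ∃ c : ℂ, Φ = c • ψ) :
    Distills ψ O S := by
  refine ⟨_, IsLOCC.done, fun Φ hΦ => ?_⟩
  obtain ⟨c, rfl⟩ := hS Φ hΦ
  refine ⟨c * star c, ?_⟩
  ext i j
  simp [Matrix.vecMulVec_apply]
  ring

theorem Distills.round {I' : P → Type u} [∀ v, Fintype (I' v)] [∀ v, DecidableEq (I' v)]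
    (k : P) {J : Type*} [Fintype J] (A : J → ∀ v, Matrix (I' v) (I v) ℂ)
    (measurement : ∑ j, (A j k)ᴴ * A j k = 1)
    (isometry : ∀ j v, v ≠ k → (A j v)ᴴ * A j v = 1)
    {S : Set ((∀ v, I v) → ℂ)} (S' : J → Set ((∀ v, I' v) → ℂ))
    (h : ∀ j, Distills ψ I' (S' j)) (hS : ∀ Φ ∈ S, ∀ j, tensorOp (A j) *ᵥ Φ ∈ S' j) :
    Distills ψ I S := by
  let e := (Fintype.equivFin J).symm
  choose Λ hΛ hΛ' using h
  refine ⟨_, IsLOCC.round (J := Fin (Fintype.card J)) k (fun _ => I') (fun j => A (e j)) ?_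
    (fun j v hv => isometry (e j) v hv) (fun j => Λ (e j)) (fun j => hΛ (e j)), ?_⟩
  · rw [e.sum_comp (fun j => (A j k)ᴴ * A j k), measurement]
  · intro Φ hΦ
    choose c hc using fun j => hΛ' j _ (hS Φ hΦ j)
    refine ⟨∑ j, c (e j), ?_⟩
    simp only [Matrix.conj_vecMulVec_star, hc]
    rw [Finset.sum_smul]

section Parallel

/-- A family of types switching between `I` and `O`. -/
def SwitchIdx (O I : P → Type u) (b : Bool) (v : P) : Type u := cond b (O v) (I v)

instance (b : Bool) (v : P) : Fintype (SwitchIdx O I b v) :=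
  match b with
  | true => inferInstanceAs (Fintype (O v))
  | false => inferInstanceAs (Fintype (I v))

instance (b : Bool) (v : P) : DecidableEq (SwitchIdx O I b v) :=
  match b with
  | true => inferInstanceAs (DecidableEq (O v))
  | false => inferInstanceAs (DecidableEq (I v))

/-- The operator which still has to be applied at `v`. -/
def switchRest {J : P → Type*} (A : ∀ v, J v → Matrix (O v) (I v) ℂ) :
    ∀ (b : Bool) (v : P), J v → Matrix (O v) (SwitchIdx O I b v) ℂ
  | true, v, _ => (1 : Matrix (O v) (O v) ℂ)
  | false, v, j => A v j

/-- The operator applied at `v` when the state of `v` changes between two values. -/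
def switchStep {J : P → Type*} (A : ∀ v, J v → Matrix (O v) (I v) ℂ) :
    ∀ (b b' : Bool) (v : P), J v → Matrix (SwitchIdx O I b' v) (SwitchIdx O I b v) ℂ
  | true, true, v, _ => (1 : Matrix (O v) (O v) ℂ)
  | false, true, v, j => A v j
  | false, false, v, _ => (1 : Matrix (I v) (I v) ℂ)
  | true, false, _, _ => 0

theorem switchStep_self {J : P → Type*} (A : ∀ v, J v → Matrix (O v) (I v) ℂ) (b : Bool) (v : P)
    (j : J v) : switchStep A b b v j = 1 := by
  cases b <;> rfl

theorem switchRest_true_mul_switchStep {J : P → Type*} (A : ∀ v, J v → Matrix (O v) (I v) ℂ)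
    (v : P) (j j' : J v) :
    switchRest A true v j * switchStep A false true v j' = switchRest A false v j' :=
  Matrix.one_mul (A v j')

theorem Distills.parallel_aux {J : P → Type*} [∀ v, Fintype (J v)] [∀ v, Nonempty (J v)]
    (A : ∀ v, J v → Matrix (O v) (I v) ℂ) (hA : ∀ v, ∑ j, (A v j)ᴴ * A v j = 1) (n : ℕ) :
    ∀ (f : P → Bool), (Finset.univ.filter fun v => f v = false).card = n →
      ∀ S : Set ((∀ v, SwitchIdx O I (f v) v) → ℂ),
      (∀ Φ ∈ S, ∀ j : ∀ v, J v,
        ∃ c : ℂ, tensorOp (fun v => switchRest A (f v) v (j v)) *ᵥ Φ = c • ψ) →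
      Distills ψ (fun v => SwitchIdx O I (f v) v) S := by
  induction n with
  | zero =>
    intro f hf S hS
    have : f = fun _ => true := by
      funext v
      have := Finset.filter_eq_empty_iff.1 (Finset.card_eq_zero.1 hf) (Finset.mem_univ v)
      simpa using this
    subst this
    have h1 : (tensorOp fun v => switchRest A true v (Classical.arbitrary (J v)))
        = (1 : Matrix (∀ v, O v) (∀ v, O v) ℂ) := tensorOp_one
    refine Distills.done (O := O) (S := S) fun Φ hΦ => ?_
    obtain ⟨c, hc⟩ := hS Φ hΦ (fun v => Classical.arbitrary _)
    refine ⟨c, ?_⟩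
    have h2 : (1 : Matrix (∀ v, O v) (∀ v, O v) ℂ) *ᵥ Φ = c • ψ := by
      rw [← hc, ← h1]
      rfl
    rwa [Matrix.one_mulVec] at h2
  | succ n ih =>
    intro f hf S hS
    obtain ⟨k, hk⟩ : (Finset.univ.filter fun v => f v = false).Nonempty := by
      rw [← Finset.card_pos]
      omega
    have hfk : f k = false := (Finset.mem_filter.1 hk).2
    let f' := Function.update f k true
    have hf'k : f' k = true := Function.update_self ..
    have hf' : ∀ v, v ≠ k → f' v = f v := fun v hv => Function.update_of_ne hv _ _
    have hcard : (Finset.univ.filter fun v => f' v = false).card = n := by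
      have : (Finset.univ.filter fun v => f' v = false)
          = (Finset.univ.filter fun v => f v = false).erase k := by
        ext v
        by_cases hv : v = k
        · subst hv
          simp [hf'k]
        · simp [hf' v hv, hv]
      rw [this, Finset.card_erase_of_mem hk, hf]
      rfl
    let j₀ : ∀ v, J v := fun v => Classical.arbitrary _
    let B : J k → ∀ v, Matrix (SwitchIdx O I (f' v) v) (SwitchIdx O I (f v) v) ℂ :=
      fun j v => switchStep A (f v) (f' v) v (Function.update j₀ k j v)
    refine Distills.round (J := J k) k B ?_ ?_
      (fun j => {Φ' | ∃ Φ ∈ S, Φ' = tensorOp (B j) *ᵥ Φ}) (fun j => ih f' hcard _ ?_)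
      (fun Φ hΦ j => ⟨Φ, hΦ, rfl⟩)
    · simp only [B, Function.update_self]
      rw [hfk, hf'k]
      exact hA k
    · intro j v hv
      simp only [B]
      rw [hf' v hv, switchStep_self]
      simp
    · rintro _ ⟨Φ, hΦ, rfl⟩ i
      obtain ⟨c, hc⟩ := hS Φ hΦ (Function.update i k j)
      refine ⟨c, ?_⟩
      rw [← hc, Matrix.mulVec_mulVec, tensorOp_mul]
      congr 2
      funext v
      by_cases hv : v = k
      · subst hv
        simp only [B, Function.update_self]
        rw [hfk, hf'k]
        exact switchRest_true_mul_switchStep A v _ _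
      · simp only [B, Function.update_of_ne hv]
        rw [hf' v hv, switchStep_self, Matrix.mul_one]

/-- Every party performs a measurement on its own system, which ends the protocol. -/
theorem Distills.parallel {J : P → Type*} [∀ v, Fintype (J v)] [∀ v, Nonempty (J v)]
    (A : ∀ v, J v → Matrix (O v) (I v) ℂ) (hA : ∀ v, ∑ j, (A v j)ᴴ * A v j = 1)
    {S : Set ((∀ v, I v) → ℂ)}
    (hS : ∀ Φ ∈ S, ∀ j : ∀ v, J v, ∃ c : ℂ, tensorOp (fun v => A v (j v)) *ᵥ Φ = c • ψ) :
    Distills ψ I S :=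
  Distills.parallel_aux (I := I) A hA _ (fun _ => false) rfl S hS

end Parallel

/-- A local change of basis. -/
theorem Distills.reindex [Nonempty P] {I' : P → Type u} [∀ v, Fintype (I' v)]
    [∀ v, DecidableEq (I' v)]
    (e : ∀ v, I v ≃ I' v) {S : Set ((∀ v, I v) → ℂ)} {S' : Set ((∀ v, I' v) → ℂ)}
    (h : Distills ψ I' S') (hS : ∀ Φ ∈ S, (fun y => Φ fun v => (e v).symm (y v)) ∈ S') :
    Distills ψ I S := by
  have hiso : ∀ v, (Matrix.of fun a b => if a = e v b then (1 : ℂ) else 0 :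
      Matrix (I' v) (I v) ℂ)ᴴ * (Matrix.of fun a b => if a = e v b then (1 : ℂ) else 0) = 1 := by
    intro v
    ext a b
    simp [Matrix.mul_apply, Matrix.one_apply, eq_comm]
  refine Distills.round (Classical.arbitrary P) (J := Unit)
    (fun _ v => Matrix.of fun a b => if a = e v b then (1 : ℂ) else 0) (by simp [hiso])
    (fun _ v _ => hiso v) (fun _ => S') (fun _ => h) (fun Φ hΦ _ => ?_)
  convert hS Φ hΦ using 1
  funext y
  simp only [Matrix.mulVec, dotProduct, tensorOp_apply, Matrix.of_apply]
  rw [Finset.sum_eq_single fun v => (e v).symm (y v)]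
  · simp
  · intro z _ hz
    obtain ⟨v, hv⟩ := Function.ne_iff.1 hz
    rw [Finset.prod_eq_zero (Finset.mem_univ v), zero_mul]
    rw [if_neg]
    rintro h
    exact hv (by simp [h])
  · simp

end LOCC

/-! ### Operators acting on some of the qudits -/

section LocalOp

variable {X W G : Type*} [Fintype X] [Fintype W] [Fintype G] [DecidableEq G] [DecidableEq W]
  [DecidableEq X]

/-- Summing over all labels which agree with `b` outside of the range of `ι`. -/
theorem sum_eq_sum_extend (ι : X → W) (hι : ι.Injective) (b : W → G) (f : (W → G) → ℂ)
    (hf : ∀ c, (∃ w ∉ Set.range ι, c w ≠ b w) → f c = 0) :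
    ∑ c, f c = ∑ z : X → G, f (Function.extend ι z b) := by
  symm
  rw [← Finset.sum_image (s := Finset.univ) (g := fun z : X → G => Function.extend ι z b) (f := f)]
  · refine Finset.sum_subset (Finset.subset_univ _) fun c _ hc => hf c ?_
    by_contra! h
    refine hc (Finset.mem_image.2 ⟨c ∘ ι, Finset.mem_univ _, ?_⟩)
    funext w
    by_cases hw : w ∈ Set.range ι
    · obtain ⟨x, rfl⟩ := hw
      rw [hι.extend_apply]
      rfl
    · rw [Function.extend_apply' _ _ _ hw, h w hw]
  · intro z _ z' _ h
    funext x
    have := congrFun h (ι x)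
    simpa [hι.extend_apply] using this

open Classical in
/-- The operator `K` on the qudits in the range of `ι`, tensored with the identity. -/
noncomputable def localOp (ι : X → W) (K : Matrix (X → G) (X → G) ℂ) :
    Matrix (W → G) (W → G) ℂ :=
  Matrix.of fun a b => if ∀ w ∉ Set.range ι, a w = b w then K (a ∘ ι) (b ∘ ι) else 0

theorem localOp_mulVec (ι : X → W) (hι : ι.Injective) (K : Matrix (X → G) (X → G) ℂ)
    (Φ : (W → G) → ℂ) (y : W → G) :
    (localOp ι K *ᵥ Φ) y = ∑ z, K (y ∘ ι) z * Φ (Function.extend ι z y) := by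
  rw [Matrix.mulVec, dotProduct, sum_eq_sum_extend ι hι y]
  · refine Finset.sum_congr rfl fun z _ => ?_
    rw [localOp, Matrix.of_apply, if_pos, Function.extend_comp hι]
    intro w hw
    rw [Function.extend_apply' _ _ _ hw]
  · rintro c ⟨w, hw, h⟩
    rw [localOp, Matrix.of_apply, if_neg, zero_mul]
    exact fun h' => h (h' w hw).symm

theorem localOp_mul (ι : X → W) (hι : ι.Injective) (K K' : Matrix (X → G) (X → G) ℂ) :
    localOp ι K * localOp ι K' = localOp ι (K * K') := by
  ext a b
  have := localOp_mulVec ι hι K (fun c => localOp ι K' c b) a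
  rw [Matrix.mulVec, dotProduct] at this
  rw [Matrix.mul_apply, this]
  simp only [localOp, Matrix.of_apply]
  have h1 : ∀ z : X → G, (∀ w ∉ Set.range ι, Function.extend ι z a w = b w)
      ↔ ∀ w ∉ Set.range ι, a w = b w := by
    intro z
    refine forall₂_congr fun w hw => ?_
    rw [Function.extend_apply' _ _ _ hw]
  simp only [h1, Function.extend_comp hι]
  split_ifs
  · rw [Matrix.mul_apply]
  · simp

theorem localOp_conjTranspose (ι : X → W) (K : Matrix (X → G) (X → G) ℂ) :
    (localOp ι K)ᴴ = localOp ι Kᴴ := by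
  ext a b
  simp only [localOp, Matrix.of_apply, Matrix.conjTranspose_apply]
  have : (∀ w ∉ Set.range ι, b w = a w) ↔ ∀ w ∉ Set.range ι, a w = b w :=
    forall₂_congr fun w hw => eq_comm
  simp only [this]
  split_ifs <;> simp

theorem localOp_one (ι : X → W) : localOp (G := G) ι 1 = 1 := by
  ext a b
  simp only [localOp, Matrix.of_apply, Matrix.one_apply]
  by_cases h : a = b
  · subst h
    simp
  · rw [if_neg h]
    split_ifs with h1 h2
    · exfalso
      apply h
      funext w
      by_cases hw : w ∈ Set.range ι
      · obtain ⟨x, rfl⟩ := hw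
        exact congrFun h2 x
      · exact h1 w hw
    · rfl
    · rfl

theorem localOp_sum {J : Type*} [Fintype J] (ι : X → W) (K : J → Matrix (X → G) (X → G) ℂ) :
    ∑ j, localOp ι (K j) = localOp ι (∑ j, K j) := by
  ext a b
  simp only [localOp, Matrix.of_apply, Matrix.sum_apply]
  split_ifs <;> simp

theorem sum_localOp_conjTranspose_mul {J : Type*} [Fintype J] (ι : X → W) (hι : ι.Injective)
    (K : J → Matrix (X → G) (X → G) ℂ) (hK : ∑ j, (K j)ᴴ * K j = 1) :
    ∑ j, (localOp ι (K j))ᴴ * localOp ι (K j) = 1 := by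
  simp only [localOp_conjTranspose, localOp_mul ι hι]
  rw [localOp_sum, hK, localOp_one]

end LocalOp

/-! ### Qudits with owners -/

section Owned

variable {P : Type u} [Fintype P] [DecidableEq P] {O : P → Type u}
  [∀ v, Fintype (O v)] [∀ v, DecidableEq (O v)] {ψ : (∀ v, O v) → ℂ}
  {Q Q' : Type u} [Fintype Q] [DecidableEq Q] [Fintype Q'] [DecidableEq Q']
  {G : Type} [Fintype G] [DecidableEq G]

/-- Labels of all qudits, grouped by owner. -/
def ownedEquiv (G : Type) (own : Q → P) : (∀ v, {q // own q = v} → G) ≃ (Q → G) where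
  toFun f q := f (own q) ⟨q, rfl⟩
  invFun y _ q := y q
  left_inv f := by
    funext v ⟨q, hq⟩
    subst hq
    rfl
  right_inv _ := rfl

/-- `Distills` for a system of qudits `Q` with owners. -/
def OwnedDistills (ψ : (∀ v, O v) → ℂ) (own : Q → P) (S : Set ((Q → G) → ℂ)) : Prop :=
  Distills ψ (fun v => {q // own q = v} → G) {Φ | (fun y => Φ ((ownedEquiv G own).symm y)) ∈ S}

theorem OwnedDistills.mono {own : Q → P} {S S' : Set ((Q → G) → ℂ)} (h : OwnedDistills ψ own S')
    (hS : S ⊆ S') : OwnedDistills ψ own S :=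
  Distills.mono h fun _ hΦ => hS hΦ

theorem OwnedDistills.relabel [Nonempty P] {own : Q → P} {own' : Q' → P} (σ : Q ≃ Q')
    (hσ : ∀ q, own' (σ q) = own q) {S : Set ((Q → G) → ℂ)} {S' : Set ((Q' → G) → ℂ)}
    (h : OwnedDistills ψ own' S') (hS : ∀ Φ ∈ S, (fun y => Φ (y ∘ σ)) ∈ S') :
    OwnedDistills ψ own S := by
  refine Distills.reindex (fun v => Equiv.arrowCongr
    (σ.subtypeEquiv fun q => by rw [hσ]) (Equiv.refl G)) h ?_
  intro Φ hΦ
  exact hS _ hΦ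

theorem OwnedDistills.localOp {own : Q → P} {X : Type*} [Fintype X] [DecidableEq X] (u : P)
    (ι : X → Q) (hι : ι.Injective) (hu : ∀ x, own (ι x) = u) {J : Type*} [Fintype J]
    (K : J → Matrix (X → G) (X → G) ℂ) (hK : ∑ j, (K j)ᴴ * K j = 1)
    {S : Set ((Q → G) → ℂ)} (S' : J → Set ((Q → G) → ℂ)) (h : ∀ j, OwnedDistills ψ own (S' j))
    (hS : ∀ Φ ∈ S, ∀ j,
      (fun y => ∑ z, K j (y ∘ ι) z * Φ (Function.extend ι z y)) ∈ S' j) :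
    OwnedDistills ψ own S := by
  let ι' : ∀ v, v = u → X → {q // own q = v} := fun v hv x => ⟨ι x, (hu x).trans hv.symm⟩
  have hι' : ∀ v hv, (ι' v hv).Injective := fun v hv x x' hx => hι (congrArg Subtype.val hx)
  let A : J → ∀ v, Matrix ({q // own q = v} → G) ({q // own q = v} → G) ℂ :=
    fun j v => if hv : v = u then _root_.localOp (ι' v hv) (K j) else 1
  have hA : ∀ j, ∀ x y : Q → G, tensorOp (A j) ((ownedEquiv G own).symm x)
      ((ownedEquiv G own).symm y) = _root_.localOp ι (K j) x y := by
    intro j x y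
    rw [tensorOp_apply, ← Finset.mul_prod_erase _ _ (Finset.mem_univ u)]
    have h1 : A j u ((ownedEquiv G own).symm x u) ((ownedEquiv G own).symm y u)
      = if ∀ w ∉ Set.range ι, own w = u → x w = y w then K j (x ∘ ι) (y ∘ ι) else 0 := by
      simp only [A, dif_pos, _root_.localOp, Matrix.of_apply]
      refine if_congr ?_ rfl rfl
      constructor
      · intro h w hw hwu
        refine h ⟨w, hwu⟩ ?_
        rintro ⟨x, hx⟩
        exact hw ⟨x, congrArg Subtype.val hx⟩
      · rintro h ⟨w, hwu⟩ hw
        refine h w ?_ hwu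
        rintro ⟨x, rfl⟩
        exact hw ⟨x, rfl⟩
    have h2 : ∏ v ∈ Finset.univ.erase u, A j v ((ownedEquiv G own).symm x v)
        ((ownedEquiv G own).symm y v) = if ∀ w, own w ≠ u → x w = y w then 1 else 0 := by
      split_ifs with h
      · refine Finset.prod_eq_one fun v hv => ?_
        have hv := Finset.ne_of_mem_erase hv
        simp only [A, dif_neg hv]
        rw [Matrix.one_apply, if_pos]
        funext ⟨w, hw⟩
        exact h w (hw ▸ hv)
      · push Not at h
        obtain ⟨w, hw, hxy⟩ := h
        refine Finset.prod_eq_zero (Finset.mem_erase.2 ⟨hw, Finset.mem_univ (own w)⟩) ?_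
        simp only [A, dif_neg hw]
        rw [Matrix.one_apply, if_neg]
        intro h
        exact hxy (congrFun h ⟨w, rfl⟩)
    rw [h1, h2]
    simp only [_root_.localOp, Matrix.of_apply]
    by_cases h3 : ∀ w ∉ Set.range ι, x w = y w
    · rw [if_pos h3, if_pos fun w hw _ => h3 w hw, if_pos, mul_one]
      intro w hw
      refine h3 w ?_
      rintro ⟨x, rfl⟩
      exact hw (hu x)
    · rw [if_neg h3]
      by_cases h4 : ∀ w, own w ≠ u → x w = y w
      · rw [if_neg, zero_mul]
        intro h5
        refine h3 fun w hw => ?_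
        by_cases hwu : own w = u
        · exact h5 w hw hwu
        · exact h4 w hwu
      · rw [if_neg h4, mul_zero]
  refine Distills.round u A ?_ ?_ (fun j => {Φ | (fun y => Φ ((ownedEquiv G own).symm y)) ∈ S' j})
    h ?_
  · simp only [A, dif_pos]
    exact sum_localOp_conjTranspose_mul _ (hι' u rfl) K hK
  · intro j v hv
    simp only [A, dif_neg hv]
    simp
  · intro Φ hΦ j
    have := hS _ hΦ j
    simp only [Set.mem_ofPred_eq]
    convert this using 1
    funext y
    rw [← localOp_mulVec ι hι (K j) (fun y => Φ ((ownedEquiv G own).symm y)) y]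
    simp only [Matrix.mulVec, dotProduct]
    rw [← (ownedEquiv G own).symm.sum_comp]
    simp only [hA]

end Owned

/-! ### Product operators -/

section PiOp

variable {ι l m n : Type*} [Fintype ι] [DecidableEq ι]

/-- The tensor product of the operators `A i` on a family of qudits with the same local space. -/
def piOp (A : ι → Matrix m n ℂ) : Matrix (ι → m) (ι → n) ℂ :=
  Matrix.of fun x y => ∏ i, A i (x i) (y i)

theorem piOp_apply (A : ι → Matrix m n ℂ) (x y) : piOp A x y = ∏ i, A i (x i) (y i) := rfl

theorem piOp_mul [Fintype m] (A : ι → Matrix l m ℂ) (B : ι → Matrix m n ℂ) :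
    piOp A * piOp B = piOp (fun i => A i * B i) := by
  ext x y
  simp only [Matrix.mul_apply, piOp_apply, ← Finset.prod_mul_distrib]
  rw [Fintype.prod_sum]

theorem piOp_conjTranspose (A : ι → Matrix m n ℂ) : (piOp A)ᴴ = piOp (fun i => (A i)ᴴ) := by
  ext x y
  simp [Matrix.conjTranspose_apply, piOp_apply]

theorem piOp_one [DecidableEq n] : piOp (fun _ : ι => (1 : Matrix n n ℂ)) = 1 := by
  ext x y
  rw [piOp_apply, Matrix.one_apply]
  split_ifs with h
  · subst h
    simp
  · obtain ⟨v, hv⟩ := Function.ne_iff.1 h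
    exact Finset.prod_eq_zero (Finset.mem_univ v) (Matrix.one_apply_ne hv)

theorem sum_piOp_conjTranspose_mul [Fintype m] [DecidableEq n] {J : Type*} [Fintype J]
    (K : J → Matrix m n ℂ) (hK : ∑ j, (K j)ᴴ * K j = 1) :
    ∑ t : ι → J, (piOp fun i => K (t i))ᴴ * piOp (fun i => K (t i)) = 1 := by
  simp only [piOp_conjTranspose, piOp_mul]
  rw [← piOp_one]
  ext x y
  simp only [Matrix.sum_apply, piOp_apply]
  rw [← Fintype.prod_sum (fun i j => ((K j)ᴴ * K j) (x i) (y i))]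
  simp only [← hK, Matrix.sum_apply]

theorem piOp_smul (c : ι → ℂ) (A : ι → Matrix m n ℂ) :
    piOp (fun i => c i • A i) = (∏ i, c i) • piOp A := by
  ext x y
  simp [piOp_apply, Finset.prod_mul_distrib]

theorem piOp_update_mulVec [Fintype n] [Fintype m] (B : ι → Matrix m n ℂ) (z : ι)
    (N : Matrix m m ℂ) (Ψ : (ι → n) → ℂ) (x : ι → m) :
    (piOp (Function.update B z (N * B z)) *ᵥ Ψ) x
      = ∑ i, N (x z) i * (piOp B *ᵥ Ψ) (Function.update x z i) := by
  have h : ∀ y, piOp (Function.update B z (N * B z)) x y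
      = ∑ i, N (x z) i * piOp B (Function.update x z i) y := by
    intro y
    simp only [piOp_apply]
    rw [← Finset.mul_prod_erase _ _ (Finset.mem_univ z), Function.update_self, Matrix.mul_apply,
      Finset.sum_mul]
    refine Finset.sum_congr rfl fun i _ => ?_
    rw [← Finset.mul_prod_erase _ _ (Finset.mem_univ z), Function.update_self, mul_assoc]
    congr 2
    refine Finset.prod_congr rfl fun j hj => ?_
    rw [Function.update_of_ne (Finset.ne_of_mem_erase hj),
      Function.update_of_ne (Finset.ne_of_mem_erase hj)]
  simp only [Matrix.mulVec, dotProduct, h, Finset.sum_mul, Finset.mul_sum]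
  rw [Finset.sum_comm]
  simp only [mul_assoc]

end PiOp

/-- A multiple of the identity. -/
def IsScalarOp {n : Type*} [DecidableEq n] (A : Matrix n n ℂ) : Prop := ∃ c : ℂ, A = c • 1

/-! ### Teleportation -/

section Bell

variable {G : Type} [Fintype G] [DecidableEq G] [AddCommGroup G]

/-- The generalised Pauli operators of a finite abelian group. -/
def weyl (s : G × AddChar G ℂ) : Matrix G G ℂ :=
  Matrix.of fun i j => if i = j + s.1 then s.2 j else 0

theorem addChar_conj_mul_self (χ : AddChar G ℂ) (j : G) : star (χ j) * χ j = 1 := by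
  have := AddChar.map_neg_eq_conj χ j
  rw [← starRingEnd_apply, ← this, ← AddChar.map_add_eq_mul]
  simp

theorem weyl_conjTranspose_mul (s : G × AddChar G ℂ) : (weyl s)ᴴ * weyl s = 1 := by
  ext j j'
  simp only [weyl, Matrix.mul_apply, Matrix.conjTranspose_apply, Matrix.of_apply, Matrix.one_apply]
  by_cases h : j = j'
  · subst h
    rw [Finset.sum_eq_single (j + s.1)]
    · simpa using addChar_conj_mul_self s.2 j
    · intro b _ hb
      simp [hb]
    · simp
  · rw [if_neg h]
    refine Finset.sum_eq_zero fun i _ => ?_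
    by_cases h1 : i = j + s.1
    · have : i ≠ j' + s.1 := fun h2 => h (add_right_cancel (h1.symm.trans h2))
      simp [this]
    · simp [h1]

theorem weyl_mul_conjTranspose (s : G × AddChar G ℂ) : weyl s * (weyl s)ᴴ = 1 :=
  mul_eq_one_comm.1 (weyl_conjTranspose_mul s)

theorem sum_weyl_mul_star (i j i' j' : G) :
    ∑ s, weyl s i j * star (weyl s i' j') = if i = i' ∧ j = j' then (Fintype.card G : ℂ) else 0 := by
  have h1 : ∀ s : G × AddChar G ℂ, weyl s i j * star (weyl s i' j')
      = if s.1 = i - j ∧ s.1 = i' - j' then s.2 (j - j') else 0 := by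
    intro s
    have e1 : i = j + s.1 ↔ s.1 = i - j := by
      rw [eq_sub_iff_add_eq, add_comm, eq_comm]
    have e2 : i' = j' + s.1 ↔ s.1 = i' - j' := by
      rw [eq_sub_iff_add_eq, add_comm, eq_comm]
    simp only [weyl, Matrix.of_apply, e1, e2]
    by_cases h1 : s.1 = i - j <;> by_cases h2 : s.1 = i' - j'
    · rw [if_pos h1, if_pos h2, if_pos ⟨h1, h2⟩, sub_eq_add_neg, AddChar.map_add_eq_mul,
        AddChar.map_neg_eq_conj]
      rfl
    · simp [h2]
    · simp [h1]
    · simp [h1]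
  simp only [h1]
  rw [Fintype.sum_prod_type]
  simp only
  by_cases h : i - j = i' - j'
  · rw [Finset.sum_eq_single (i - j)]
    · simp only [h, and_self, if_true]
      rw [AddChar.sum_apply_eq_ite]
      refine if_congr ?_ rfl rfl
      constructor
      · intro hj
        have hj := sub_eq_zero.1 hj
        subst hj
        exact ⟨sub_left_injective h, rfl⟩
      · rintro ⟨-, rfl⟩
        simp
    · intro m _ hm
      simp [hm]
    · simp
  · rw [if_neg]
    · refine Finset.sum_eq_zero fun m _ => Finset.sum_eq_zero fun χ _ => if_neg ?_
      rintro ⟨h1, h2⟩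
      exact h (h1.symm.trans h2)
    · rintro ⟨rfl, rfl⟩
      exact h rfl

end Bell

section Teleport

variable {P : Type u} [Fintype P] [DecidableEq P] {O : P → Type u}
  [∀ v, Fintype (O v)] [∀ v, DecidableEq (O v)] {ψ : (∀ v, O v) → ℂ}
  {Q : Type u} [Fintype Q] [DecidableEq Q]
  {G : Type} [Fintype G] [DecidableEq G]

theorem sum_submatrix_conjTranspose_mul {m n : Type*} [Fintype m] [DecidableEq m] [Fintype n]
    [DecidableEq n] (e : m ≃ n) {J : Type*} [Fintype J] (K : J → Matrix n n ℂ)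
    (hK : ∑ j, (K j)ᴴ * K j = 1) :
    ∑ j, ((K j).submatrix e e)ᴴ * (K j).submatrix e e = 1 := by
  have h : ∀ j, ((K j).submatrix e e)ᴴ * (K j).submatrix e e = ((K j)ᴴ * K j).submatrix e e := by
    intro j
    rw [Matrix.conjTranspose_submatrix, Matrix.submatrix_mul_equiv]
  simp only [h]
  have h2 : ∑ j, ((K j)ᴴ * K j).submatrix e e = (∑ j, (K j)ᴴ * K j).submatrix e e := by
    ext a b
    simp [Matrix.sum_apply]
  rw [h2, hK, Matrix.submatrix_one_equiv]

theorem OwnedDistills.localOp_single {own : Q → P} (b : Q) {J : Type*} [Fintype J]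
    (K : J → Matrix G G ℂ) (hK : ∑ j, (K j)ᴴ * K j = 1)
    {S : Set ((Q → G) → ℂ)} (S' : J → Set ((Q → G) → ℂ)) (h : ∀ j, OwnedDistills ψ own (S' j))
    (hS : ∀ Φ ∈ S, ∀ j, (fun y => ∑ k, K j (y b) k * Φ (Function.update y b k)) ∈ S' j) :
    OwnedDistills ψ own S := by
  let e : (Unit → G) ≃ G := Equiv.funUnique Unit G
  refine OwnedDistills.localOp (X := Unit) (own b) (fun _ => b) (fun _ _ _ => rfl) (fun _ => rfl)
    (fun j => (K j).submatrix e e) (sum_submatrix_conjTranspose_mul e K hK) S' h ?_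
  intro Φ hΦ j
  convert hS Φ hΦ j using 1
  funext y
  rw [← e.sum_comp]
  refine Finset.sum_congr rfl fun z _ => ?_
  have : Function.extend (fun _ : Unit => b) z y = Function.update y b (e z) := by
    funext w
    by_cases hw : w = b
    · subst hw
      rw [Function.update_self]
      exact Function.Injective.extend_apply (f := fun _ : Unit => w) (fun _ _ _ => rfl) z y ()
    · rw [Function.update_of_ne hw, Function.extend_apply']
      rintro ⟨_, h⟩
      exact hw h.symm
  rw [this]
  rfl

theorem OwnedDistills.localOp_pair {own : Q → P} (q a : Q) (hqa : q ≠ a) (hown : own a = own q)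
    {J : Type*} [Fintype J]
    (K : J → Matrix (G × G) (G × G) ℂ) (hK : ∑ j, (K j)ᴴ * K j = 1)
    {S : Set ((Q → G) → ℂ)} (S' : J → Set ((Q → G) → ℂ)) (h : ∀ j, OwnedDistills ψ own (S' j))
    (hS : ∀ Φ ∈ S, ∀ s, (fun y => ∑ i, ∑ j, K s (y q, y a) (i, j) *
      Φ (Function.update (Function.update y q i) a j)) ∈ S' s) :
    OwnedDistills ψ own S := by
  let e : (Bool → G) ≃ G × G := Equiv.boolArrowEquivProd G
  have hinj : Function.Injective (fun x : Bool => cond x a q) := by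
    intro x x' h
    cases x <;> cases x' <;> simp_all
  refine OwnedDistills.localOp (X := Bool) (own q) (fun x => cond x a q) hinj ?_
    (fun j => (K j).submatrix e e) (sum_submatrix_conjTranspose_mul e K hK) S' h ?_
  · rintro (_ | _)
    · rfl
    · exact hown
  intro Φ hΦ j
  convert hS Φ hΦ j using 1
  funext y
  rw [← Fintype.sum_prod_type' (fun i k => K j (y q, y a) (i, k) *
      Φ (Function.update (Function.update y q i) a k)), ← e.sum_comp]
  refine Finset.sum_congr rfl fun z _ => ?_
  have : Function.extend (fun x : Bool => cond x a q) z y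
      = Function.update (Function.update y q (e z).1) a (e z).2 := by
    funext w
    by_cases hw : w = a
    · subst hw
      rw [Function.update_self]
      exact hinj.extend_apply z y true
    · rw [Function.update_of_ne hw]
      by_cases hw' : w = q
      · subst hw'
        rw [Function.update_self]
        exact hinj.extend_apply z y false
      · rw [Function.update_of_ne hw', Function.extend_apply']
        rintro ⟨_ | _, h⟩
        · exact hw' h.symm
        · exact hw h.symm
  rw [this]
  rfl

/-- The qudit `q` is teleported with the help of the pair `a`, `b`: the owner of `q` and `a`
performs a Bell measurement and the owner of `b` applies a correction. Afterwards `b` takes the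
name of `q`. -/
theorem OwnedDistills.teleport [AddCommGroup G] {own : Q → P} (q a b : Q) (hqa : q ≠ a)
    (hqb : q ≠ b) (hab : a ≠ b) (hown : own a = own q) {S S' : Set ((Q → G) → ℂ)}
    (h : OwnedDistills ψ (own ∘ Equiv.swap q b) S')
    (hS : ∀ Φ ∈ S, ∀ s : G × AddChar G ℂ,
      (fun y => if y a = 0 ∧ y b = 0 then ∑ k, ∑ i, ∑ j, ((Real.sqrt (Fintype.card G))⁻¹ : ℂ) *
        (weyl s (y q) k * star (weyl s i j) *
          Φ (Function.update (Function.update (Function.update y q i) a j) b k)) else 0) ∈ S') :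
    OwnedDistills ψ own S := by
  have : Nonempty P := ⟨own q⟩
  set c : ℂ := ((Real.sqrt (Fintype.card G))⁻¹ : ℂ) with hc
  have hc2 : c * c * (Fintype.card G : ℂ) = 1 := by
    have h1 : (0 : ℝ) < Fintype.card G := by exact_mod_cast Fintype.card_pos
    rw [hc, ← mul_inv, ← Complex.ofReal_mul, Real.mul_self_sqrt h1.le]
    simp
  have hcs : star c = c := by
    rw [hc, ← Complex.ofReal_inv]
    exact Complex.conj_ofReal _
  let K : G × AddChar G ℂ → Matrix (G × G) (G × G) ℂ := fun s =>
    Matrix.of fun x y => if x = 0 then c * star (weyl s y.1 y.2) else 0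
  have hK : ∑ s, (K s)ᴴ * K s = 1 := by
    ext x y
    simp only [Matrix.sum_apply, Matrix.mul_apply, Matrix.conjTranspose_apply, K, Matrix.of_apply]
    have h1 : ∀ s : G × AddChar G ℂ, ∑ z : G × G, star (if z = 0 then c * star (weyl s x.1 x.2) else 0) *
        (if z = 0 then c * star (weyl s y.1 y.2) else 0)
        = c * c * (weyl s x.1 x.2 * star (weyl s y.1 y.2)) := by
      intro s
      rw [Finset.sum_eq_single 0]
      · simp only [if_true, star_mul, star_star, hcs]
        ring
      · intro z _ hz
        simp [hz]
      · simp
    simp only [h1]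
    rw [← Finset.mul_sum, sum_weyl_mul_star, Matrix.one_apply]
    simp only [Prod.ext_iff]
    split_ifs
    · exact hc2
    · simp
  have hswap : ∀ y : Q → G, ∀ i j k,
      Function.update (Function.update (Function.update (y ∘ Equiv.swap q b) b k) q i) a j
      = Function.update (Function.update (Function.update y q i) a j) b k := by
    intro y i j k
    funext w
    by_cases h1 : w = a
    · subst h1
      simp [hab]
    · by_cases h2 : w = b
      · subst h2
        simp [h1, hqb.symm]
      · by_cases h3 : w = q
        · subst h3
          simp [h1, h2]
        · simp [h1, h2, h3, Equiv.swap_apply_of_ne_of_ne]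
  refine OwnedDistills.localOp_pair q a hqa hown K hK
    (fun s => {Φ' | ∃ Φ ∈ S, Φ' = fun y => ∑ i, ∑ j, K s (y q, y a) (i, j) *
      Φ (Function.update (Function.update y q i) a j)}) (fun s => ?_) (fun Φ hΦ s => ⟨Φ, hΦ, rfl⟩)
  refine OwnedDistills.localOp_single b (J := Unit) (fun _ => weyl s)
    (by simp [weyl_conjTranspose_mul]) (fun _ => {Φ' | ∃ Φ ∈ S, Φ' = fun y => ∑ k, weyl s (y b) k *
      ∑ i, ∑ j, K s ((Function.update y b k) q, (Function.update y b k) a) (i, j) *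
      Φ (Function.update (Function.update (Function.update y b k) q i) a j)}) (fun _ => ?_) ?_
  · refine OwnedDistills.relabel (Equiv.swap q b) (own' := own ∘ Equiv.swap q b) (by simp) h ?_
    rintro _ ⟨Φ, hΦ, rfl⟩
    convert hS Φ hΦ s using 1
    funext y
    simp only [hswap, K, Matrix.of_apply]
    simp only [Function.update_of_ne hqb, Function.update_of_ne hab, Function.comp_apply,
      Equiv.swap_apply_left, Equiv.swap_apply_right, Equiv.swap_apply_of_ne_of_ne hqa.symm hab,
      Prod.mk_eq_zero, and_comm (a := y b = 0)]
    split_ifs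
    · simp only [Finset.mul_sum]
      refine Finset.sum_congr rfl fun k _ => Finset.sum_congr rfl fun i _ =>
        Finset.sum_congr rfl fun j _ => ?_
      ring
    · simp
  · rintro _ ⟨Φ, hΦ, rfl⟩ _
    exact ⟨Φ, hΦ, rfl⟩

end Teleport

/-! ### Sending qudits along routes -/

section Transport

variable {P : Type u} [Fintype P] [DecidableEq P] {O : P → Type u}
  [∀ v, Fintype (O v)] [∀ v, DecidableEq (O v)] {ψ : (∀ v, O v) → ℂ}
  {Z E : Type u} [Fintype Z] [DecidableEq Z] [Fintype E] [DecidableEq E]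
  {G : Type} [Fintype G] [DecidableEq G]

/-- Data qudits `Z` in the state `Ψ`, with the operators `B` applied to them, together with pairs
of qudits `E` in the states with coefficients `M`. -/
def dataPairState (Ψ : (Z → G) → ℂ) (B : Z → Matrix G G ℂ) (M : E → Matrix G G ℂ) :
    (Z ⊕ (E × Bool) → G) → ℂ := fun y =>
  (piOp B *ᵥ Ψ) (y ∘ Sum.inl) * ∏ e, M e (y (Sum.inr (e, false))) (y (Sum.inr (e, true)))

/-- The coefficients of a pair seen from side `β`. -/
def pairSide (β : Bool) (M : Matrix G G ℂ) : Matrix G G ℂ := cond β Mᵀ M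

theorem dataPairState_update (Ψ : (Z → G) → ℂ) (B : Z → Matrix G G ℂ) (M : E → Matrix G G ℂ)
    (z : Z) (e : E) (β : Bool) (y : Z ⊕ (E × Bool) → G) (i j k : G) :
    dataPairState Ψ B M (Function.update (Function.update (Function.update y (Sum.inl z) i)
      (Sum.inr (e, β)) j) (Sum.inr (e, !β)) k)
    = (piOp B *ᵥ Ψ) (Function.update (y ∘ Sum.inl) z i) * (pairSide β (M e) j k *
      ∏ e' ∈ Finset.univ.erase e, M e' (y (Sum.inr (e', false))) (y (Sum.inr (e', true)))) := by
  rw [dataPairState, ← Finset.mul_prod_erase _ _ (Finset.mem_univ e)]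
  congr 1
  · congr 1
    funext w
    by_cases hw : w = z
    · subst hw
      simp
    · simp [hw]
  · congr 1
    · cases β <;> simp [pairSide]
    · refine Finset.prod_congr rfl fun e' he' => ?_
      have := Finset.ne_of_mem_erase he'
      simp [this]

theorem dataPairState_teleport [AddCommGroup G] (Ψ : (Z → G) → ℂ) (B : Z → Matrix G G ℂ)
    (M : E → Matrix G G ℂ) (z : Z) (e : E) (β : Bool) (s : G × AddChar G ℂ) (c : ℂ) :
    (fun y : Z ⊕ (E × Bool) → G => if y (Sum.inr (e, β)) = 0 ∧ y (Sum.inr (e, !β)) = 0 then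
      ∑ k, ∑ i, ∑ j, c * (weyl s (y (Sum.inl z)) k * star (weyl s i j) *
        dataPairState Ψ B M (Function.update (Function.update (Function.update y (Sum.inl z) i)
          (Sum.inr (e, β)) j) (Sum.inr (e, !β)) k)) else 0)
    = dataPairState Ψ
        (Function.update B z (c • (weyl s * (pairSide β (M e))ᵀ * (weyl s)ᴴ) * B z))
        (Function.update M e (Matrix.single 0 0 1)) := by
  funext y
  simp only [dataPairState_update]
  rw [dataPairState, ← Finset.mul_prod_erase _ _ (Finset.mem_univ e), piOp_update_mulVec,
    Function.update_self]
  have h1 : ∏ e' ∈ Finset.univ.erase e, (Function.update M e (Matrix.single 0 0 1)) e'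
        (y (Sum.inr (e', false))) (y (Sum.inr (e', true)))
      = ∏ e' ∈ Finset.univ.erase e, M e' (y (Sum.inr (e', false))) (y (Sum.inr (e', true))) := by
    refine Finset.prod_congr rfl fun e' he' => ?_
    rw [Function.update_of_ne (Finset.ne_of_mem_erase he')]
  rw [h1]
  have h2 : (Matrix.single 0 0 1 : Matrix G G ℂ) (y (Sum.inr (e, false))) (y (Sum.inr (e, true)))
      = if y (Sum.inr (e, β)) = 0 ∧ y (Sum.inr (e, !β)) = 0 then 1 else 0 := by
    rw [Matrix.single_apply]
    refine if_congr ?_ rfl rfl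
    cases β <;> simp [eq_comm, and_comm]
  rw [h2]
  split_ifs
  · simp only [Finset.sum_mul, one_mul, Matrix.smul_apply, Matrix.mul_apply, Finset.mul_sum,
      smul_eq_mul, Matrix.transpose_apply, Matrix.conjTranspose_apply, Function.comp_apply]
    rw [Finset.sum_comm]
    refine Finset.sum_congr rfl fun i _ => ?_
    rw [Finset.sum_comm]
    refine Finset.sum_congr rfl fun j _ => Finset.sum_congr rfl fun k _ => ?_
    ring
  · simp

theorem isScalarOp_conj_pairSide [AddCommGroup G] {M B : Matrix G G ℂ} (hM : IsScalarOp M)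
    (hB : IsScalarOp B) (β : Bool) (s : G × AddChar G ℂ) (c : ℂ) :
    IsScalarOp (c • (weyl s * (pairSide β M)ᵀ * (weyl s)ᴴ) * B) := by
  obtain ⟨m, rfl⟩ := hM
  obtain ⟨b, rfl⟩ := hB
  refine ⟨c * m * b, ?_⟩
  have : (pairSide β (m • (1 : Matrix G G ℂ)))ᵀ = m • 1 := by
    cases β <;> simp [pairSide]
  rw [this]
  simp [weyl_mul_conjTranspose, smul_smul, mul_comm, mul_left_comm]

/-- A list of pairs, each with a side on which it is entered, leading from `u` to `w`. -/
def IsRoute (own : E × Bool → P) : P → List (E × Bool) → P → Prop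
  | u, [], w => u = w
  | u, s :: l, w => own s = u ∧ IsRoute own (own (s.1, !s.2)) l w

theorem IsRoute.congr {own own' : E × Bool → P} {l : List (E × Bool)} :
    ∀ {u w : P}, IsRoute own u l w → (∀ e ∈ l.map Prod.fst, ∀ β, own' (e, β) = own (e, β)) →
      IsRoute own' u l w := by
  induction l with
  | nil => exact fun h _ => h
  | cons s l ih =>
    rintro u w ⟨h1, h2⟩ h
    have hs := h s.1 (by simp)
    refine ⟨(hs s.2).trans h1, ?_⟩
    rw [hs]
    exact ih h2 fun e he β => h e (List.mem_cons_of_mem _ he) β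

/-- Data qudits are teleported along edge-disjoint routes. The qudits on whose route all pairs are
maximally entangled arrive unharmed. -/
theorem OwnedDistills.transport [AddCommGroup G] (Ψ : (Z → G) → ℂ) (tgt : Z → P)
    (𝒢 : Set (Set Z)) (h𝒢 : ∀ s ∈ 𝒢, ∀ t ⊆ s, t ∈ 𝒢)
    (hfin : ∀ own : Z ⊕ (E × Bool) → P, (∀ z, own (Sum.inl z) = tgt z) → OwnedDistills ψ own
      {Φ | ∃ (B : Z → Matrix G G ℂ) (M : E → Matrix G G ℂ),
        {z | ¬ IsScalarOp (B z)} ∈ 𝒢 ∧ Φ = dataPairState Ψ B M}) (n : ℕ) :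
    ∀ (own : Z ⊕ (E × Bool) → P) (r : Z → List (E × Bool)), ∑ z, (r z).length = n →
      (∀ z, IsRoute (own ∘ Sum.inr) (own (Sum.inl z)) (r z) (tgt z)) →
      (∀ z, ((r z).map Prod.fst).Nodup) →
      (∀ z z', z ≠ z' → ((r z).map Prod.fst).Disjoint ((r z').map Prod.fst)) →
      OwnedDistills ψ own
        {Φ | ∃ (B : Z → Matrix G G ℂ) (M : E → Matrix G G ℂ),
          {z | ¬ (IsScalarOp (B z) ∧ ∀ e ∈ (r z).map Prod.fst, IsScalarOp (M e))} ∈ 𝒢 ∧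
          Φ = dataPairState Ψ B M} := by
  induction n with
  | zero =>
    intro own r hn hr _ _
    have hr0 : ∀ z, r z = [] := by
      intro z
      have := Finset.sum_eq_zero_iff.1 hn z (Finset.mem_univ z)
      exact List.eq_nil_of_length_eq_zero this
    refine (hfin own fun z => ?_).mono ?_
    · have := hr z
      rw [hr0] at this
      exact this
    · rintro Φ ⟨B, M, h1, h2⟩
      refine ⟨B, M, h𝒢 _ h1 _ fun z hz => ?_, h2⟩
      exact fun h => hz h.1
  | succ n ih =>
    intro own r hn hr hnodup hdisj
    obtain ⟨z, hz⟩ : ∃ z, r z ≠ [] := by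
      by_contra! h
      simp [h] at hn
    obtain ⟨⟨e, β⟩, l, hl⟩ := List.exists_cons_of_ne_nil hz
    have hroute := hr z
    have hnd := hnodup z
    rw [hl] at hroute hnd
    simp only [List.map_cons, List.nodup_cons] at hnd
    obtain ⟨hown, hroute⟩ := hroute
    have he : ∀ z', z' ≠ z → e ∉ (r z').map Prod.fst := by
      intro z' hz' hmem
      refine hdisj z z' hz'.symm ?_ hmem
      rw [hl]
      simp
    have hown' : ∀ e' ≠ e, ∀ γ, (own ∘ Equiv.swap (Sum.inl z) (Sum.inr (e, !β)))
        (Sum.inr (e', γ)) = own (Sum.inr (e', γ)) := by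
      intro e' he' γ
      rw [Function.comp_apply, Equiv.swap_apply_of_ne_of_ne]
      · simp
      · simp [he']
    refine OwnedDistills.teleport (Sum.inl z) (Sum.inr (e, β)) (Sum.inr (e, !β)) (by simp)
      (by simp) (by simp) hown (ih _ (Function.update r z l) ?_ ?_ ?_ ?_) ?_
    · rw [← Finset.add_sum_erase _ _ (Finset.mem_univ z), Function.update_self]
      rw [← Finset.add_sum_erase _ _ (Finset.mem_univ z), hl, List.length_cons] at hn
      have : ∑ x ∈ Finset.univ.erase z, (Function.update r z l x).length
          = ∑ x ∈ Finset.univ.erase z, (r x).length :=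
        Finset.sum_congr rfl fun x hx => by
          rw [Function.update_of_ne (Finset.ne_of_mem_erase hx)]
      omega
    · intro z'
      by_cases hz' : z' = z
      · subst hz'
        rw [Function.update_self]
        simp only [Function.comp_apply, Equiv.swap_apply_left]
        refine hroute.congr fun e' he' γ => hown' e' ?_ γ
        rintro rfl
        exact hnd.1 he'
      · rw [Function.update_of_ne hz']
        have : (own ∘ Equiv.swap (Sum.inl z) (Sum.inr (e, !β))) (Sum.inl z')
            = own (Sum.inl z') := by
          rw [Function.comp_apply, Equiv.swap_apply_of_ne_of_ne]
          · simpa using hz'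
          · simp
        rw [this]
        refine (hr z').congr fun e' he' γ => hown' e' ?_ γ
        rintro rfl
        exact he z' hz' he'
    · intro z'
      by_cases hz' : z' = z
      · subst hz'
        rw [Function.update_self]
        exact hnd.2
      · rw [Function.update_of_ne hz']
        exact hnodup z'
    · have hsub : ∀ z' e', e' ∈ (Function.update r z l z').map Prod.fst →
          e' ∈ (r z').map Prod.fst := by
        intro z' e' he'
        by_cases hz' : z' = z
        · subst hz'
          rw [Function.update_self] at he'
          rw [hl]
          exact List.mem_cons_of_mem _ he'
        · rwa [Function.update_of_ne hz'] at he'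
      intro z₁ z₂ h12 e' h1 h2
      exact hdisj z₁ z₂ h12 (hsub _ _ h1) (hsub _ _ h2)
    · rintro _ ⟨B, M, hbad, rfl⟩ s
      rw [dataPairState_teleport]
      refine ⟨_, _, h𝒢 _ hbad _ fun z' hz' hgood => hz' ?_, rfl⟩
      by_cases hzz : z' = z
      · subst hzz
        rw [Function.update_self, Function.update_self]
        rw [hl] at hgood
        obtain ⟨hB, hM⟩ := hgood
        refine ⟨isScalarOp_conj_pairSide (hM e (by simp)) hB β s _, fun e' he' => ?_⟩
        rw [Function.update_of_ne]
        · exact hM e' (List.mem_cons_of_mem _ he')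
        · rintro rfl
          exact hnd.1 he'
      · rw [Function.update_of_ne hzz, Function.update_of_ne hzz]
        refine ⟨hgood.1, fun e' he' => ?_⟩
        rw [Function.update_of_ne]
        · exact hgood.2 e' he'
        · rintro rfl
          exact he z' hzz he'

end Transport

/-! ### Quantum codes -/

/-- A code which encodes one qudit with local basis `G` in the qudits `X`, with a recovery
operation. -/
structure QuantumCode (X G : Type) [Fintype X] [DecidableEq X] [Fintype G] [DecidableEq G] where
  Outcome : Type
  fintypeOutcome : Fintype Outcome
  enc : Matrix (X → G) G ℂ
  enc_isometry : encᴴ * enc = 1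
  recover : Outcome → Matrix G (X → G) ℂ
  complete : ∑ s, (recover s)ᴴ * recover s = 1

attribute [instance] QuantumCode.fintypeOutcome

namespace QuantumCode

variable {X X' G : Type} [Fintype X] [DecidableEq X] [Fintype X'] [DecidableEq X'] [Fintype G]
  [DecidableEq G]

/-- The operator on the encoded qudit caused by the errors `A` after recovery with outcome `s`. -/
def effect (C : QuantumCode X G) (A : X → Matrix G G ℂ) (s : C.Outcome) : Matrix G G ℂ :=
  C.recover s * piOp A * C.enc

/-- Arbitrary errors on the qudits in `F` are corrected. -/
def Corrects (C : QuantumCode X G) (F : Set X) : Prop :=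
  ∀ A : X → Matrix G G ℂ, (∀ i ∉ F, IsScalarOp (A i)) → ∀ s, IsScalarOp (C.effect A s)

theorem Corrects.mono {C : QuantumCode X G} {F F' : Set X} (h : C.Corrects F) (hF : F' ⊆ F) :
    C.Corrects F' :=
  fun A hA s => h A (fun i hi => hA i fun h' => hi (hF h')) s

theorem nonempty_outcome [Nonempty G] (C : QuantumCode X G) : Nonempty C.Outcome := by
  by_contra h
  rw [not_nonempty_iff] at h
  have := C.complete
  rw [Finset.univ_eq_empty, Finset.sum_empty] at this
  have h2 := congrFun (congrFun this (fun _ => Classical.arbitrary G)) (fun _ => Classical.arbitrary G)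
  simp at h2

/-- Concatenation: every qudit of the outer code is encoded with the inner code. -/
def comp (C : QuantumCode X G) (C' : QuantumCode X' G) : QuantumCode (X × X') G where
  Outcome := C.Outcome × (X → C'.Outcome)
  fintypeOutcome := inferInstance
  enc := (piOp (fun _ : X => C'.enc) * C.enc).submatrix (Equiv.curry X X' G) id
  enc_isometry := by
    have h : ((piOp (fun _ : X => C'.enc) * C.enc).submatrix (Equiv.curry X X' G) id)ᴴ *
        (piOp (fun _ : X => C'.enc) * C.enc).submatrix (Equiv.curry X X' G) id
        = (piOp (fun _ : X => C'.enc) * C.enc)ᴴ * (piOp (fun _ : X => C'.enc) * C.enc) := by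
      rw [Matrix.conjTranspose_submatrix, Matrix.submatrix_mul_equiv, Matrix.submatrix_id_id]
    rw [h, Matrix.conjTranspose_mul, piOp_conjTranspose, Matrix.mul_assoc,
      ← Matrix.mul_assoc _ _ C.enc, piOp_mul]
    simp only [C'.enc_isometry]
    rw [piOp_one, Matrix.one_mul, C.enc_isometry]
  recover s := (C.recover s.1 * piOp (fun i => C'.recover (s.2 i))).submatrix id
    (Equiv.curry X X' G)
  complete := by
    have h : ∀ s : C.Outcome × (X → C'.Outcome),
        ((C.recover s.1 * piOp (fun i => C'.recover (s.2 i))).submatrix id (Equiv.curry X X' G))ᴴ *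
          (C.recover s.1 * piOp (fun i => C'.recover (s.2 i))).submatrix id (Equiv.curry X X' G)
        = ((piOp (fun i => C'.recover (s.2 i)))ᴴ * ((C.recover s.1)ᴴ * C.recover s.1) *
          piOp (fun i => C'.recover (s.2 i))).submatrix
            (Equiv.curry X X' G) (Equiv.curry X X' G) := by
      intro s
      rw [Matrix.conjTranspose_submatrix]
      have := Matrix.submatrix_mul_equiv
        (C.recover s.1 * piOp (fun i => C'.recover (s.2 i)))ᴴ
        (C.recover s.1 * piOp (fun i => C'.recover (s.2 i))) (Equiv.curry X X' G) (Equiv.refl G)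
        (Equiv.curry X X' G)
      refine Eq.trans this ?_
      rw [Matrix.conjTranspose_mul]
      simp only [Matrix.mul_assoc]
    simp only [h]
    rw [Fintype.sum_prod_type]
    rw [Finset.sum_comm]
    have h2 : ∀ t : X → C'.Outcome, ∑ s, ((piOp (fun i => C'.recover (t i)))ᴴ *
        ((C.recover s)ᴴ * C.recover s) * piOp (fun i => C'.recover (t i))).submatrix
            (Equiv.curry X X' G) (Equiv.curry X X' G)
        = ((piOp (fun i => C'.recover (t i)))ᴴ * piOp (fun i => C'.recover (t i))).submatrix
            (Equiv.curry X X' G) (Equiv.curry X X' G) := by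
      intro t
      have h3 : (piOp (fun i => C'.recover (t i)))ᴴ * piOp (fun i => C'.recover (t i))
          = ∑ s, (piOp (fun i => C'.recover (t i)))ᴴ * ((C.recover s)ᴴ * C.recover s) *
            piOp (fun i => C'.recover (t i)) := by
        rw [← Matrix.sum_mul, ← Matrix.mul_sum, C.complete, Matrix.mul_one]
      rw [h3]
      ext a b
      simp [Matrix.sum_apply]
    simp only [h2]
    have h3 := sum_piOp_conjTranspose_mul (ι := X) C'.recover C'.complete
    rw [← Matrix.submatrix_one_equiv (Equiv.curry X X' G), ← h3]
    ext a b
    simp [Matrix.sum_apply]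

theorem effect_comp (C : QuantumCode X G) (C' : QuantumCode X' G) (A : X × X' → Matrix G G ℂ)
    (s : C.Outcome) (t : X → C'.Outcome) :
    (C.comp C').effect A (s, t)
      = C.effect (fun i => C'.effect (fun j => A (i, j)) (t i)) s := by
  have h : piOp A = (piOp fun i => piOp fun j => A (i, j)).submatrix (Equiv.curry X X' G)
      (Equiv.curry X X' G) := by
    ext a b
    simp only [Matrix.submatrix_apply, piOp_apply]
    rw [Fintype.prod_prod_type]
    rfl
  change (C.recover s * piOp (fun i => C'.recover (t i))).submatrix id (Equiv.curry X X' G) *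
    piOp A * (piOp (fun _ : X => C'.enc) * C.enc).submatrix (Equiv.curry X X' G) id = _
  rw [h, Matrix.submatrix_mul_equiv, Matrix.submatrix_mul_equiv, Matrix.submatrix_id_id]
  simp only [effect, ← piOp_mul, Matrix.mul_assoc]

theorem Corrects.comp {C : QuantumCode X G} {C' : QuantumCode X' G} {F : Set (X × X')}
    (h : C.Corrects {i | ¬ C'.Corrects {j | (i, j) ∈ F}}) : (C.comp C').Corrects F := by
  rintro A hA ⟨s, t⟩
  rw [effect_comp]
  refine h _ (fun i hi => ?_) _
  simp only [Set.mem_ofPred_eq, not_not] at hi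
  exact hi _ (fun j hj => hA _ hj) _

/-- The trivial code. -/
def trivial (G : Type) [Fintype G] [DecidableEq G] : QuantumCode Unit G where
  Outcome := Unit
  fintypeOutcome := inferInstance
  enc := (1 : Matrix G G ℂ).submatrix (Equiv.funUnique Unit G) id
  enc_isometry := by
    rw [Matrix.conjTranspose_submatrix, Matrix.submatrix_mul_equiv]
    simp
  recover _ := (1 : Matrix G G ℂ).submatrix id (Equiv.funUnique Unit G)
  complete := by
    rw [Matrix.conjTranspose_submatrix]
    have := Matrix.submatrix_mul_equiv ((1 : Matrix G G ℂ)ᴴ) 1 (Equiv.funUnique Unit G)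
      (Equiv.refl G) (Equiv.funUnique Unit G)
    rw [Fintype.sum_unique]
    refine Eq.trans this ?_
    simp only [Matrix.conjTranspose_one, Matrix.one_mul]
    exact Matrix.submatrix_one_equiv _

theorem trivial_corrects {F : Set Unit} (h : () ∉ F) : (trivial G).Corrects F := by
  intro A hA s
  obtain ⟨c, hc⟩ := hA () h
  refine ⟨c, ?_⟩
  have h : piOp A = (A ()).submatrix (Equiv.funUnique Unit G) (Equiv.funUnique Unit G) := by
    ext a b
    simp [piOp_apply]
  rw [effect, h]
  simp only [trivial]
  rw [Matrix.submatrix_mul_equiv, Matrix.submatrix_mul_equiv, Matrix.submatrix_id_id, hc]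
  simp

end QuantumCode

/-! ### Threefold repetition codes -/

section Syndrome

variable {H : Type*} [AddCommGroup H] [DecidableEq H]

/-- The error on three sites deduced from the two differences `s`, by majority. -/
def majorityError (s : H × H) : Fin 3 → H :=
  if s.1 = s.2 then ![-s.1, 0, 0] else ![0, s.1, s.2]

theorem majorityError_one_sub (s : H × H) : majorityError s 1 - majorityError s 0 = s.1 := by
  rw [majorityError]
  split_ifs <;> simp

theorem majorityError_two_sub (s : H × H) : majorityError s 2 - majorityError s 0 = s.2 := by
  rw [majorityError]
  split_ifs with h <;> simp [h]

theorem majorityError_eq_zero (s : H × H) {j k : Fin 3} (hjk : j ≠ k)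
    (h : majorityError s j = majorityError s k) : majorityError s j = 0 := by
  rw [majorityError] at h ⊢
  split_ifs at h ⊢ with hs
  · fin_cases j <;> fin_cases k <;> simp_all
  · fin_cases j <;> fin_cases k <;> simp_all [eq_comm]

/-- Labels of three sites are given by an error and a common value. -/
def majorityEquiv : (H × H) × H ≃ (Fin 3 → H) where
  toFun t i := t.2 + majorityError t.1 i
  invFun y := ((y 1 - y 0, y 2 - y 0), y 0 - majorityError (y 1 - y 0, y 2 - y 0) 0)
  left_inv := by
    rintro ⟨s, x⟩
    have h1 : x + majorityError s 1 - (x + majorityError s 0) = s.1 := by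
      rw [add_sub_add_left_eq_sub, majorityError_one_sub]
    have h2 : x + majorityError s 2 - (x + majorityError s 0) = s.2 := by
      rw [add_sub_add_left_eq_sub, majorityError_two_sub]
    simp [h1, h2]
  right_inv y := by
    have h1 := majorityError_one_sub (y 1 - y 0, y 2 - y 0)
    have h2 := majorityError_two_sub (y 1 - y 0, y 2 - y 0)
    have h1' := sub_eq_iff_eq_add.1 h1
    have h2' := sub_eq_iff_eq_add.1 h2
    funext i
    fin_cases i
    · simp
    · simp [h1']
    · simp [h2']

end Syndrome

theorem Fin.exists_two_ne (i : Fin 3) : ∃ j k : Fin 3, j ≠ i ∧ k ≠ i ∧ j ≠ k := by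
  decide +revert

namespace QuantumCode

variable {G : Type} [Fintype G] [DecidableEq G] [AddCommGroup G]

/-- The threefold repetition code. -/
def bitRepetition (G : Type) [Fintype G] [DecidableEq G] [AddCommGroup G] :
    QuantumCode (Fin 3) G where
  Outcome := G × G
  fintypeOutcome := inferInstance
  enc := Matrix.of fun y x => if y = fun _ => x then 1 else 0
  enc_isometry := by
    ext x x'
    simp only [Matrix.mul_apply, Matrix.conjTranspose_apply, Matrix.of_apply]
    rw [Finset.sum_eq_single fun _ => x]
    · simp [Matrix.one_apply, funext_iff]
    · intro y _ hy
      simp [hy]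
    · simp
  recover s := Matrix.of fun x y => if y = majorityEquiv (s, x) then 1 else 0
  complete := by
    ext y y'
    simp only [Matrix.sum_apply, Matrix.mul_apply, Matrix.conjTranspose_apply, Matrix.of_apply]
    rw [← Fintype.sum_prod_type' (fun s x => star (if y = majorityEquiv (s, x) then (1 : ℂ) else 0) *
      (if y' = majorityEquiv (s, x) then (1 : ℂ) else 0))]
    rw [majorityEquiv.sum_comp (fun w => star (if y = w then (1 : ℂ) else 0) *
      (if y' = w then (1 : ℂ) else 0))]
    simp [Matrix.one_apply]

theorem effect_bitRepetition (A : Fin 3 → Matrix G G ℂ) (s : G × G) (x x' : G) :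
    (bitRepetition G).effect A s x x' = ∏ i, A i (x + majorityError s i) x' := by
  change (Matrix.of (fun x y => if y = majorityEquiv (s, x) then (1 : ℂ) else 0) * piOp A *
    Matrix.of fun y x => if y = fun _ => x then (1 : ℂ) else 0 : Matrix G G ℂ) x x' = _
  simp only [Matrix.mul_apply, Matrix.of_apply, mul_ite, mul_one, mul_zero,
    Finset.sum_ite_eq', Finset.mem_univ, if_true]
  rw [Finset.sum_eq_single (majorityEquiv (s, x))]
  · simp [piOp_apply, majorityEquiv]
  · intro y _ hy
    simp [hy]
  · simp

theorem isScalarOp_effect_bitRepetition (A : Fin 3 → Matrix G G ℂ) (hA : ∀ i, IsScalarOp (A i))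
    (s : G × G) : IsScalarOp ((bitRepetition G).effect A s) := by
  choose c hc using hA
  refine ⟨if majorityError s = 0 then ∏ i, c i else 0, ?_⟩
  ext x x'
  rw [effect_bitRepetition]
  simp only [hc, Matrix.smul_apply, smul_eq_mul, Matrix.one_apply, Finset.prod_mul_distrib]
  by_cases h : majorityError s = 0
  · rw [if_pos h]
    by_cases hx : x = x' <;> simp [h, hx]
  · rw [if_neg h, zero_mul, mul_eq_zero]
    right
    by_contra h2
    rw [← ne_eq, Finset.prod_ne_zero_iff] at h2
    have h3 : ∀ i, x + majorityError s i = x' := by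
      intro i
      have := h2 i (Finset.mem_univ i)
      by_contra h4
      exact this (if_neg h4)
    apply h
    funext i
    obtain ⟨j, k, hj, -, -⟩ := Fin.exists_two_ne i
    exact majorityError_eq_zero s hj.symm (add_left_cancel ((h3 i).trans (h3 j).symm))

theorem isDiag_effect_bitRepetition (A : Fin 3 → Matrix G G ℂ) (i : Fin 3)
    (hA : ∀ j, j ≠ i → IsScalarOp (A j)) (s : G × G) :
    ((bitRepetition G).effect A s).IsDiag := by
  intro x x' hx
  rw [effect_bitRepetition]
  obtain ⟨j, k, hj, hk, hjk⟩ := Fin.exists_two_ne i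
  obtain ⟨c, hc⟩ := hA j hj
  obtain ⟨c', hc'⟩ := hA k hk
  by_contra h2
  rw [← ne_eq, Finset.prod_ne_zero_iff] at h2
  have h3 : x + majorityError s j = x' := by
    by_contra h4
    exact h2 j (Finset.mem_univ j) (by simp [hc, h4])
  have h4 : x + majorityError s k = x' := by
    by_contra h4
    exact h2 k (Finset.mem_univ k) (by simp [hc', h4])
  have h5 := majorityError_eq_zero s hjk (add_left_cancel (h3.trans h4.symm))
  rw [h5, add_zero] at h3
  exact hx h3

/-- Triples are given by their sum and their last two entries. -/
def sumEquiv (G : Type) [AddCommGroup G] : G × G × G ≃ (Fin 3 → G) where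
  toFun t := ![t.1 - t.2.1 - t.2.2, t.2.1, t.2.2]
  invFun y := (∑ i, y i, y 1, y 2)
  left_inv := by
    rintro ⟨x, b, c⟩
    simp [Fin.sum_univ_three]
    abel
  right_inv y := by
    funext i
    fin_cases i
    · simp [Fin.sum_univ_three]
      abel
    · simp
    · simp

theorem sum_ite_sum_eq (F : (Fin 3 → G) → ℂ) (x : G) :
    ∑ y : Fin 3 → G, (if ∑ i, y i = x then F y else 0)
      = ∑ b, ∑ c, F ![x - b - c, b, c] := by
  rw [← (sumEquiv G).sum_comp, Fintype.sum_prod_type]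
  have h : ∀ a : G × G × G, ∑ i, sumEquiv G a i = a.1 := by
    rintro ⟨x, b, c⟩
    simp [Fin.sum_univ_three, sumEquiv]
    abel
  simp only [h]
  rw [Finset.sum_eq_single x]
  · simp only [if_true]
    rw [Fintype.sum_prod_type]
    rfl
  · intro b _ hb
    simp [hb]
  · simp

theorem card_inv_mul_cancel :
    ((Fintype.card G : ℂ)⁻¹ * (Fintype.card G : ℂ)⁻¹) * ((Fintype.card G : ℂ) * Fintype.card G)
      = 1 := by
  have : (Fintype.card G : ℂ) ≠ 0 := by
    exact_mod_cast Fintype.card_ne_zero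
  field_simp

theorem prod_majorityError_apply [DecidableEq (AddChar G ℂ)] (s : AddChar G ℂ × AddChar G ℂ)
    (y : Fin 3 → G) (hy : ∑ i, y i = 0) :
    ∏ i, majorityError s i (y i) = s.1 (y 1) * s.2 (y 2) := by
  have h0 : y 0 = -y 1 + -y 2 := by
    rw [Fin.sum_univ_three] at hy
    have := eq_neg_of_add_eq_zero_left hy
    have h2 : y 0 = -y 2 - y 1 := by
      rw [← this]
      abel
    rw [h2]
    abel
  have h1 := majorityError_one_sub s
  have h2 := majorityError_two_sub s
  rw [sub_eq_iff_eq_add] at h1 h2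
  rw [Fin.prod_univ_three, h1, h2, h0]
  simp only [AddChar.add_apply, AddChar.map_add_eq_mul, AddChar.map_neg_eq_inv]
  have e1 : majorityError s 0 (y 1) ≠ 0 := right_ne_zero_of_mul_eq_one (addChar_conj_mul_self _ _)
  have e2 : majorityError s 0 (y 2) ≠ 0 := right_ne_zero_of_mul_eq_one (addChar_conj_mul_self _ _)
  field_simp

open Classical in
/-- The Fourier transform of the threefold repetition code. -/
noncomputable def phaseRepetition (G : Type) [Fintype G] [DecidableEq G] [AddCommGroup G] :
    QuantumCode (Fin 3) G where
  Outcome := AddChar G ℂ × AddChar G ℂ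
  fintypeOutcome := inferInstance
  enc := Matrix.of fun y x => if ∑ i, y i = x then (Fintype.card G : ℂ)⁻¹ else 0
  enc_isometry := by
    ext x x'
    simp only [Matrix.mul_apply, Matrix.conjTranspose_apply, Matrix.of_apply]
    by_cases hx : x = x'
    · subst hx
      have h : ∀ y : Fin 3 → G, star (if ∑ i, y i = x then (Fintype.card G : ℂ)⁻¹ else 0) *
          (if ∑ i, y i = x then (Fintype.card G : ℂ)⁻¹ else 0)
          = if ∑ i, y i = x then (Fintype.card G : ℂ)⁻¹ * (Fintype.card G : ℂ)⁻¹ else 0 := by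
        intro y
        split_ifs <;> simp
      simp only [h]
      rw [sum_ite_sum_eq, Matrix.one_apply_eq, ← card_inv_mul_cancel (G := G)]
      simp only [Finset.sum_const, Finset.card_univ, nsmul_eq_mul]
      ring
    · rw [Matrix.one_apply_ne hx]
      refine Finset.sum_eq_zero fun y _ => ?_
      by_cases h1 : ∑ i, y i = x
      · have : ∑ i, y i ≠ x' := fun h => hx (h1.symm.trans h)
        simp [this]
      · simp [h1]
  recover s := Matrix.of fun x y => if ∑ i, y i = x then
    (Fintype.card G : ℂ)⁻¹ * ∏ i, star (majorityError s i (y i)) else 0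
  complete := by
    ext y y'
    simp only [Matrix.sum_apply, Matrix.mul_apply, Matrix.conjTranspose_apply, Matrix.of_apply]
    by_cases hy : ∑ i, y i = ∑ i, y' i
    · have h : ∀ s : AddChar G ℂ × AddChar G ℂ, ∑ x, star (if ∑ i, y i = x then
          (Fintype.card G : ℂ)⁻¹ * ∏ i, star (majorityError s i (y i)) else 0) *
          (if ∑ i, y' i = x then
            (Fintype.card G : ℂ)⁻¹ * ∏ i, star (majorityError s i (y' i)) else 0)
          = ((Fintype.card G : ℂ)⁻¹ * (Fintype.card G : ℂ)⁻¹) *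
            (s.1 (y 1 - y' 1) * s.2 (y 2 - y' 2)) := by
        intro s
        rw [Finset.sum_eq_single (∑ i, y i)]
        · rw [if_pos rfl, if_pos hy.symm]
          have h1 := prod_majorityError_apply s (y - y') (by simp [hy])
          simp only [Pi.sub_apply] at h1
          rw [← h1]
          simp only [star_mul', star_prod, star_star, sub_eq_add_neg, AddChar.map_add_eq_mul,
            AddChar.map_neg_eq_conj, Finset.prod_mul_distrib, starRingEnd_apply]
          simp
          ring
        · intro x _ hx
          simp [Ne.symm hx]
        · simp
      simp only [h]
      rw [← Finset.mul_sum, Fintype.sum_prod_type' (fun (s t : AddChar G ℂ) =>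
        s (y 1 - y' 1) * t (y 2 - y' 2))]
      simp only [← Finset.mul_sum]
      rw [← Finset.sum_mul, AddChar.sum_apply_eq_ite, AddChar.sum_apply_eq_ite]
      by_cases hyy : y = y'
      · subst hyy
        simpa using card_inv_mul_cancel (G := G)
      · rw [Matrix.one_apply_ne hyy]
        by_cases h1 : y 1 - y' 1 = 0
        · rw [if_pos h1, if_neg, mul_zero, mul_zero]
          intro h2
          apply hyy
          have h1 := sub_eq_zero.1 h1
          have h2 := sub_eq_zero.1 h2
          simp only [Fin.sum_univ_three, h1, h2, add_left_inj] at hy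
          funext i
          fin_cases i
          · exact hy
          · exact h1
          · exact h2
        · rw [if_neg h1, zero_mul, mul_zero]
    · rw [Matrix.one_apply_ne fun h => hy (by rw [h])]
      refine Finset.sum_eq_zero fun s _ => Finset.sum_eq_zero fun x _ => ?_
      by_cases h1 : ∑ i, y i = x
      · have : ∑ i, y' i ≠ x := fun h => hy (h1.trans h.symm)
        simp [this]
      · simp [h1]

theorem sum_ite_shift (h : Fin 3 → G → ℂ) (j : Fin 3) (t : G) (l : ℂ)
    (hl : ∀ y, h j (y + t) = l * h j y) (x : G) :
    ∑ y : Fin 3 → G, (if ∑ i, y i = x + t then ∏ i, h i (y i) else 0)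
      = l * ∑ y : Fin 3 → G, (if ∑ i, y i = x then ∏ i, h i (y i) else 0) := by
  rw [← Equiv.sum_comp (Equiv.addRight (Pi.single j t : Fin 3 → G)), Finset.mul_sum]
  refine Finset.sum_congr rfl fun y _ => ?_
  have h1 : ∑ i, (y + Pi.single j t : Fin 3 → G) i = ∑ i, y i + t := by
    simp [Finset.sum_add_distrib]
  have h2 : ∏ i, h i ((y + Pi.single j t : Fin 3 → G) i) = l * ∏ i, h i (y i) := by
    rw [← Finset.mul_prod_erase _ _ (Finset.mem_univ j),
      ← Finset.mul_prod_erase _ _ (Finset.mem_univ j), ← mul_assoc]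
    congr 1
    · simp [hl]
    · refine Finset.prod_congr rfl fun i hi => ?_
      simp [Finset.ne_of_mem_erase hi]
  simp only [Equiv.coe_addRight, h1, h2, add_left_inj]
  split_ifs <;> simp

open Classical in
theorem effect_phaseRepetition (D : Fin 3 → G → ℂ) (s : AddChar G ℂ × AddChar G ℂ) (x x' : G) :
    (phaseRepetition G).effect (fun i => Matrix.diagonal (D i)) s x x'
      = if x = x' then ((Fintype.card G : ℂ)⁻¹ * (Fintype.card G : ℂ)⁻¹) *
        ∑ y : Fin 3 → G, (if ∑ i, y i = x then
          ∏ i, star (majorityError s i (y i)) * D i (y i) else 0) else 0 := by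
  change (Matrix.of (fun x (y : Fin 3 → G) => if ∑ i, y i = x then
    (Fintype.card G : ℂ)⁻¹ * ∏ i, star (majorityError s i (y i)) else 0) *
    piOp (fun i => Matrix.diagonal (D i)) *
    Matrix.of fun (y : Fin 3 → G) x => if ∑ i, y i = x then (Fintype.card G : ℂ)⁻¹ else 0) x x' = _
  have hpi : piOp (fun i => Matrix.diagonal (D i)) = Matrix.diagonal (fun y : Fin 3 → G =>
      ∏ i, D i (y i)) := by
    ext y y'
    rw [piOp_apply, Matrix.diagonal_apply]
    split_ifs with h
    · subst h
      simp
    · obtain ⟨v, hv⟩ := Function.ne_iff.1 h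
      exact Finset.prod_eq_zero (Finset.mem_univ v) (Matrix.diagonal_apply_ne _ hv)
  rw [hpi, Matrix.mul_apply]
  simp only [Matrix.mul_diagonal, Matrix.of_apply]
  by_cases hx : x = x'
  · subst hx
    rw [if_pos rfl, Finset.mul_sum]
    refine Finset.sum_congr rfl fun y _ => ?_
    split_ifs
    · rw [Finset.prod_mul_distrib]
      ring
    · simp
  · rw [if_neg hx]
    refine Finset.sum_eq_zero fun y _ => ?_
    by_cases h1 : ∑ i, y i = x
    · have : ∑ i, y i ≠ x' := fun h => hx (h1.symm.trans h)
      simp [this]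
    · simp [h1]

theorem isScalarOp_effect_phaseRepetition (A : Fin 3 → Matrix G G ℂ) (i : Fin 3)
    (hi : (A i).IsDiag) (hA : ∀ j, j ≠ i → IsScalarOp (A j)) (s : AddChar G ℂ × AddChar G ℂ) :
    IsScalarOp ((phaseRepetition G).effect A s) := by
  classical
  have hdiag : ∀ j, (A j).IsDiag := by
    intro j
    by_cases hj : j = i
    · exact hj ▸ hi
    · obtain ⟨c, hc⟩ := hA j hj
      rw [hc]
      exact Matrix.IsDiag.smul c Matrix.isDiag_one
  have hD : A = fun j => Matrix.diagonal ((A j).diag) := by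
    funext j
    exact ((hdiag j).diagonal_diag).symm
  let h : Fin 3 → G → ℂ := fun j y => star (majorityError s j y) * (A j).diag y
  let g : G → ℂ := fun x => ∑ y : Fin 3 → G, (if ∑ i, y i = x then ∏ i, h i (y i) else 0)
  have hshift : ∀ j, j ≠ i → ∀ x t, g (x + t) = star (majorityError s j t) * g x := by
    intro j hj x t
    refine sum_ite_shift h j t _ (fun y => ?_) x
    obtain ⟨c, hc⟩ := hA j hj
    simp only [h, hc, AddChar.map_add_eq_mul, star_mul']
    simp
    ring
  have hg : ∀ x, g x = g 0 := by
    intro x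
    obtain ⟨j, k, hj, hk, hjk⟩ := Fin.exists_two_ne i
    by_cases hjk' : majorityError s j = majorityError s k
    · have := hshift j hj 0 x
      rw [majorityError_eq_zero s hjk hjk'] at this
      simpa using this
    · obtain ⟨t, ht⟩ := DFunLike.ne_iff.1 hjk'
      have h0 : ∀ x, g x = 0 := by
        intro x
        have h1 := (hshift j hj x t).symm.trans (hshift k hk x t)
        by_contra h2
        exact ht (star_injective (mul_right_cancel₀ h2 h1))
      rw [h0, h0]
  refine ⟨((Fintype.card G : ℂ)⁻¹ * (Fintype.card G : ℂ)⁻¹) * g 0, ?_⟩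
  ext x x'
  rw [hD, effect_phaseRepetition, Matrix.smul_apply, Matrix.one_apply]
  split_ifs
  · rw [smul_eq_mul, mul_one, ← hg x]
  · simp

/-- A code with nine qudits which corrects an arbitrary error on a single qudit. -/
noncomputable def shor (G : Type) [Fintype G] [DecidableEq G] [AddCommGroup G] :
    QuantumCode (Fin 3 × Fin 3) G :=
  (phaseRepetition G).comp (bitRepetition G)

theorem shor_corrects {F : Set (Fin 3 × Fin 3)} (hF : F.Subsingleton) : (shor G).Corrects F := by
  rintro A hA ⟨s, t⟩
  obtain ⟨i, hi⟩ : ∃ i, F ⊆ {i} := by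
    rcases hF.eq_empty_or_singleton with h | ⟨i, h⟩
    · exact ⟨0, by simp [h]⟩
    · exact ⟨i, h.le⟩
  change IsScalarOp (((phaseRepetition G).comp (bitRepetition G)).effect A (s, t))
  rw [effect_comp]
  refine isScalarOp_effect_phaseRepetition _ i.1 ?_ ?_ s
  · refine isDiag_effect_bitRepetition _ i.2 (fun j hj => hA _ fun h => ?_) _
    exact hj (congrArg Prod.snd (hi h))
  · intro k hk
    refine isScalarOp_effect_bitRepetition _ (fun j => hA _ fun h => ?_) _
    exact hk (congrArg Prod.fst (hi h))

/-- Concatenated codes. Errors which are not corrected contain one of few large sets. -/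
theorem exists_concatenated (G : Type) [Fintype G] [DecidableEq G] [AddCommGroup G] (r : ℕ) :
    ∃ (X : Type) (_ : Fintype X) (_ : DecidableEq X) (C : QuantumCode X G)
      (W : Finset (Finset X)), 81 * W.card ≤ 81 ^ 2 ^ r ∧ (∀ T ∈ W, T.card = 2 ^ r) ∧
      ∀ F : Set X, (∀ T ∈ W, ¬ (T : Set X) ⊆ F) → C.Corrects F := by
  induction r with
  | zero =>
    refine ⟨Unit, inferInstance, inferInstance, trivial G, {{()}}, by simp, by simp, ?_⟩
    intro F hF
    refine trivial_corrects fun h => ?_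
    exact hF {()} (by simp) (by simpa using h)
  | succ r ih =>
    obtain ⟨X, _, _, C, W, hW, hT, hF⟩ := ih
    let Y := Fin 3 × Fin 3
    let f : (Y × Y) × (Finset X × Finset X) → Finset (Y × X) := fun a =>
      ({a.1.1} ×ˢ a.2.1) ∪ ({a.1.2} ×ˢ a.2.2)
    refine ⟨Y × X, inferInstance, inferInstance, (shor G).comp C,
      (((Finset.univ : Finset (Y × Y)).filter fun a => a.1 ≠ a.2) ×ˢ (W ×ˢ W)).image f, ?_, ?_, ?_⟩
    · have h1 : ((((Finset.univ : Finset (Y × Y)).filter fun a => a.1 ≠ a.2) ×ˢ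
          (W ×ˢ W)).image f).card ≤ 81 * (W.card * W.card) := by
        refine Finset.card_image_le.trans ?_
        rw [Finset.card_product, Finset.card_product]
        refine Nat.mul_le_mul_right _ ?_
        refine (Finset.card_filter_le _ _).trans ?_
        simp [Y]
      calc _ ≤ 81 * (81 * (W.card * W.card)) := Nat.mul_le_mul_left _ h1
        _ = (81 * W.card) * (81 * W.card) := by ring
        _ ≤ 81 ^ 2 ^ r * 81 ^ 2 ^ r := Nat.mul_le_mul hW hW
        _ = 81 ^ 2 ^ (r + 1) := by rw [← pow_add, pow_succ, mul_two]
    · intro T hTm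
      obtain ⟨⟨⟨i, j⟩, T₁, T₂⟩, ha, rfl⟩ := Finset.mem_image.1 hTm
      simp only [Finset.mem_product, Finset.mem_filter, Finset.mem_univ, true_and] at ha
      obtain ⟨hij, h1, h2⟩ := ha
      rw [Finset.card_union_of_disjoint]
      · simp only [Finset.card_product, Finset.card_singleton, hT _ h1, hT _ h2]
        ring
      · rw [Finset.disjoint_left]
        rintro ⟨k, x⟩ h3 h4
        simp only [Finset.mem_product, Finset.mem_singleton] at h3 h4
        exact hij (h3.1.symm.trans h4.1)
    · intro F hno
      refine Corrects.comp (shor_corrects ?_)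
      intro i hi j hj
      by_contra hij
      simp only [Set.mem_ofPred_eq] at hi hj
      have hi' : ∃ T ∈ W, (T : Set X) ⊆ {x | (i, x) ∈ F} := by
        by_contra! h
        exact hi (hF _ h)
      have hj' : ∃ T ∈ W, (T : Set X) ⊆ {x | (j, x) ∈ F} := by
        by_contra! h
        exact hj (hF _ h)
      obtain ⟨T₁, h1, h1'⟩ := hi'
      obtain ⟨T₂, h2, h2'⟩ := hj'
      refine hno (f ((i, j), (T₁, T₂))) (Finset.mem_image_of_mem _ ?_) ?_
      · simp [hij, h1, h2]
      · rintro ⟨k, x⟩ hx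
        simp only [f, Finset.coe_union, Finset.coe_product, Set.mem_union, Set.mem_prod,
          Finset.coe_singleton, Set.mem_singleton_iff] at hx
        rcases hx with ⟨rfl, hx⟩ | ⟨rfl, hx⟩
        · exact h1' hx
        · exact h2' hx

end QuantumCode

/-! ### The protocol -/

section Prepare

variable {P : Type u} [Fintype P] [DecidableEq P] {O : P → Type u}
  [∀ v, Fintype (O v)] [∀ v, DecidableEq (O v)] {ψ : (∀ v, O v) → ℂ}
  {Z H : Type u} [Fintype Z] [DecidableEq Z] [Fintype H] [DecidableEq H]
  {G : Type} [Fintype G] [DecidableEq G]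

/-- The labels of the qudits of one party, split into two kinds. -/
def ownedSumEquiv (G : Type) (own : Z ⊕ H → P) (v : P) :
    ({q // own q = v} → G) ≃ ({z // own (Sum.inl z) = v} → G) × ({q // own (Sum.inr q) = v} → G) :=
  (Equiv.arrowCongr Equiv.subtypeSum (Equiv.refl G)).trans (Equiv.sumArrowEquivProdArrow _ _ _)

/-- A party prepares new qudits. -/
theorem OwnedDistills.prepare {own : H → P} (v₀ : P) (Ψ : (Z → G) → ℂ)
    (hΨ : ∑ z, star (Ψ z) * Ψ z = 1) {S : Set ((H → G) → ℂ)} {S' : Set ((Z ⊕ H → G) → ℂ)}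
    (h : OwnedDistills ψ (Sum.elim (fun _ => v₀) own) S')
    (hS : ∀ Φ ∈ S, (fun y => Ψ (y ∘ Sum.inl) * Φ (y ∘ Sum.inr)) ∈ S') :
    OwnedDistills ψ own S := by
  let own' : Z ⊕ H → P := Sum.elim (fun _ => v₀) own
  let χ : ∀ v, ({z : Z // own' (Sum.inl z) = v} → G) → ℂ := fun v z =>
    if h : v₀ = v then Ψ (fun z' => z ⟨z', h⟩) else 1
  have hχ : ∀ v, ∑ z, star (χ v z) * χ v z = 1 := by
    intro v
    by_cases hv : v₀ = v
    · let e : (Z → G) ≃ ({z : Z // own' (Sum.inl z) = v} → G) :=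
        Equiv.arrowCongr (Equiv.subtypeUnivEquiv fun z => hv).symm (Equiv.refl G)
      rw [← e.sum_comp, ← hΨ]
      refine Finset.sum_congr rfl fun z _ => ?_
      simp only [χ, dif_pos hv]
      rfl
    · have : IsEmpty {z : Z // own' (Sum.inl z) = v} := ⟨fun z => hv z.2⟩
      simp [χ, hv]
  let e : ∀ v, ({q // own' q = v} → G) ≃ ({z : Z // own' (Sum.inl z) = v} → G) ×
    ({q // own q = v} → G) := fun v => ownedSumEquiv G own' v
  let N : ∀ v, Matrix (({z : Z // own' (Sum.inl z) = v} → G) × ({q // own q = v} → G))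
      ({q // own q = v} → G) ℂ := fun v => Matrix.of fun a b => χ v a.1 * if a.2 = b then 1 else 0
  have hN : ∀ v, (N v)ᴴ * N v = 1 := by
    intro v
    ext b b'
    simp only [N, Matrix.mul_apply, Matrix.conjTranspose_apply, Matrix.of_apply]
    rw [Fintype.sum_prod_type, Finset.sum_comm, Finset.sum_eq_single b]
    · simp only [if_true, mul_one, ← mul_assoc]
      by_cases hb : b = b'
      · simp only [if_pos hb, mul_one]
        rw [hχ, hb, Matrix.one_apply_eq]
      · simp only [if_neg hb, mul_zero, Finset.sum_const_zero]
        rw [Matrix.one_apply_ne hb]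
    · intro c _ hc
      simp [hc]
    · simp
  have hA : ∀ v, ((N v).submatrix (e v) id)ᴴ *
      (N v).submatrix (e v) id = 1 := by
    intro v
    rw [Matrix.conjTranspose_submatrix, Matrix.submatrix_mul_equiv, hN, Matrix.submatrix_id_id]
  refine Distills.round v₀ (J := Unit) (fun _ v => (N v).submatrix (e v) id)
    (by rw [Fintype.sum_unique]; exact hA v₀) (fun _ v _ => hA v)
    (fun _ => {Φ | (fun y => Φ ((ownedEquiv G own').symm y)) ∈ S'}) (fun _ => h) ?_
  intro Φ hΦ _
  simp only [Set.mem_ofPred_eq]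
  convert hS _ hΦ using 1
  funext y
  simp only [Matrix.mulVec, dotProduct]
  rw [Finset.sum_eq_single ((ownedEquiv G own).symm (y ∘ Sum.inr))]
  · congr 1
    rw [tensorOp_apply]
    have h1 : ∀ v, (N v).submatrix (e v) id ((ownedEquiv G own').symm y v)
        ((ownedEquiv G own).symm (y ∘ Sum.inr) v)
        = if v₀ = v then Ψ (y ∘ Sum.inl) else 1 := by
      intro v
      simp only [Matrix.submatrix_apply, N, Matrix.of_apply, id]
      have h2 : (e v ((ownedEquiv G own').symm y v)).2
        = (ownedEquiv G own).symm (y ∘ Sum.inr) v := rfl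
      rw [if_pos h2, mul_one]
      by_cases hv : v₀ = v
      · simp only [χ, dif_pos hv, if_pos hv]
        rfl
      · simp only [χ, dif_neg hv, if_neg hv]
    have h3 := Finset.prod_congr (s₁ := Finset.univ) rfl fun v _ => h1 v
    refine Eq.trans h3 ?_
    simp
  · intro x _ hx
    obtain ⟨v, hv⟩ := Function.ne_iff.1 hx
    refine mul_eq_zero_of_left ?_ _
    refine Finset.prod_eq_zero (Finset.mem_univ v) ?_
    refine mul_eq_zero_of_right _ (if_neg fun h => hv ?_)
    exact h.symm
  · simp

end Prepare

theorem sum_recover_discard {W D J m n : Type*} [Fintype W] [DecidableEq W] [Fintype D]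
    [DecidableEq D] [Fintype J] [Fintype m] [DecidableEq n] (K : J → Matrix m n ℂ)
    (hK : ∑ j, (K j)ᴴ * K j = 1) :
    ∑ j : (W → J) × D,
      (Matrix.of fun (x : W → m) (y : (W → n) × D) =>
        piOp (fun w => K (j.1 w)) x y.1 * if y.2 = j.2 then 1 else 0)ᴴ *
      (Matrix.of fun (x : W → m) (y : (W → n) × D) =>
        piOp (fun w => K (j.1 w)) x y.1 * if y.2 = j.2 then 1 else 0) = 1 := by
  have h := sum_piOp_conjTranspose_mul (ι := W) K hK
  ext y y'
  rw [Matrix.sum_apply, Fintype.sum_prod_type]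
  simp only [Matrix.mul_apply, Matrix.conjTranspose_apply, Matrix.of_apply]
  rw [Finset.sum_comm, Finset.sum_eq_single y.2]
  · have h2 := congrFun (congrFun h y.1) y'.1
    rw [Matrix.sum_apply] at h2
    simp only [Matrix.mul_apply, Matrix.conjTranspose_apply] at h2
    simp only [if_true, mul_one, ← mul_assoc, ← Finset.sum_mul]
    by_cases h4 : y'.2 = y.2
    · simp only [if_pos h4, mul_one]
      rw [h2, Matrix.one_apply, Matrix.one_apply]
      simp only [Prod.ext_iff, h4, and_true]
    · simp only [if_neg h4, mul_zero, Finset.sum_const_zero]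
      rw [Matrix.one_apply_ne]
      exact fun h => h4 (by rw [h])
  · intro b _ hb
    simp [hb.symm]
  · simp

section Protocol

variable {P : Type u} [Fintype P] [DecidableEq P]
  {T E : Type u} [Fintype T] [DecidableEq T] [Fintype E] [DecidableEq E]
  {G : Type} [Fintype G] [DecidableEq G] {X : Type} [Fintype X] [DecidableEq X]

/-- The state `ψ`, with every qudit encoded in `C`. -/
def QuantumCode.encodeAll (C : QuantumCode X G) (ψ : (T → G) → ℂ) (y : T × X → G) : ℂ :=
  (piOp (fun _ : T => C.enc) *ᵥ ψ) (Function.curry y)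

theorem QuantumCode.sum_star_mul_encodeAll (C : QuantumCode X G) (ψ : (T → G) → ℂ) :
    ∑ y, star (C.encodeAll ψ y) * C.encodeAll ψ y = ∑ x, star (ψ x) * ψ x := by
  have h1 := (Equiv.curry T X G).sum_comp (fun y => star ((piOp (fun _ : T => C.enc) *ᵥ ψ) y) *
    (piOp (fun _ : T => C.enc) *ᵥ ψ) y)
  refine Eq.trans h1 ?_
  have h2 : (piOp (fun _ : T => C.enc))ᴴ * piOp (fun _ : T => C.enc) = 1 := by
    rw [piOp_conjTranspose, piOp_mul]
    simp only [C.enc_isometry]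
    exact piOp_one
  change star (piOp (fun _ : T => C.enc) *ᵥ ψ) ⬝ᵥ (piOp (fun _ : T => C.enc) *ᵥ ψ) = star ψ ⬝ᵥ ψ
  rw [Matrix.star_mulVec, Matrix.dotProduct_mulVec, Matrix.vecMul_vecMul, h2, Matrix.vecMul_one]

theorem piOp_mulVec_encodeAll (C : QuantumCode X G) (ψ : (T → G) → ℂ)
    (B : T × X → Matrix G G ℂ) (y : T → X → G) :
    (piOp B *ᵥ C.encodeAll ψ) (Function.uncurry y)
      = ((piOp fun t => piOp fun i => B (t, i)) *ᵥ (piOp (fun _ : T => C.enc) *ᵥ ψ)) y := by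
  rw [Matrix.mulVec, dotProduct, ← (Equiv.curry T X G).symm.sum_comp, Matrix.mulVec, dotProduct]
  refine Finset.sum_congr rfl fun z _ => ?_
  congr 1
  rw [piOp_apply, Fintype.prod_prod_type]
  rfl

/-- The target state, as a state of all parties. -/
def partyState (tgt : T → P) (ψ : (T → G) → ℂ) : (∀ v, {w // tgt w = v} → G) → ℂ :=
  fun f => ψ fun w => f (tgt w) ⟨w, rfl⟩

/-- All pairs of qudits are discarded, and the encoded qudits are recovered. -/
theorem OwnedDistills.decode [Nonempty G] (own : (T × X) ⊕ (E × Bool) → P) (tgt : T → P)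
    (hown : ∀ z, own (Sum.inl z) = tgt z.1) (C : QuantumCode X G) (ψ : (T → G) → ℂ) :
    OwnedDistills (partyState tgt ψ) own
      {Φ | ∃ (B : T × X → Matrix G G ℂ) (M : E → Matrix G G ℂ),
        {z | ¬ IsScalarOp (B z)} ∈ {F | ∀ t, C.Corrects {i | (t, i) ∈ F}} ∧
        Φ = dataPairState (C.encodeAll ψ) B M} := by
  have : Nonempty C.Outcome := C.nonempty_outcome
  let e₁ : ∀ v, ({z : T × X // own (Sum.inl z) = v} → G) ≃ ({w // tgt w = v} → X → G) := fun v =>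
    { toFun := fun y w i => y ⟨(w.1, i), (hown _).trans w.2⟩
      invFun := fun y z => y ⟨z.1.1, (hown _).symm.trans z.2⟩ z.1.2
      left_inv := fun _ => rfl
      right_inv := fun _ => rfl }
  let e : ∀ v, ({q // own q = v} → G) ≃
      ({w // tgt w = v} → X → G) × ({q // own (Sum.inr q) = v} → G) := fun v =>
    (ownedSumEquiv G own v).trans (Equiv.prodCongr (e₁ v) (Equiv.refl _))
  let J : P → Type u := fun v =>
    ({w // tgt w = v} → C.Outcome) × ({q : E × Bool // own (Sum.inr q) = v} → G)
  let N : ∀ v, J v → Matrix ({w // tgt w = v} → G)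
      (({w // tgt w = v} → X → G) × ({q // own (Sum.inr q) = v} → G)) ℂ := fun v j =>
    Matrix.of fun x y => piOp (fun w => C.recover (j.1 w)) x y.1 * if y.2 = j.2 then 1 else 0
  have hN : ∀ v, ∑ j, (N v j)ᴴ * N v j = 1 := by
    intro v
    exact sum_recover_discard C.recover C.complete
  refine Distills.parallel (J := J) (fun v j => (N v j).submatrix id (e v)) ?_ ?_
  · intro v
    rw [← Matrix.submatrix_one_equiv (e v), ← hN v]
    ext a b
    simp only [Matrix.sum_apply, Matrix.submatrix_apply, Matrix.mul_apply,
      Matrix.conjTranspose_apply, id]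
  · rintro Φ ⟨B, M, hF, hΦ⟩ j
    have hscal : ∀ t, IsScalarOp (C.effect (fun i => B (t, i)) ((j (tgt t)).1 ⟨t, rfl⟩)) := by
      intro t
      refine hF t _ (fun i hi => ?_) _
      simpa using hi
    choose c hc using hscal
    let h : E × Bool → G := fun q => (j (own (Sum.inr q))).2 ⟨q, rfl⟩
    refine ⟨(∏ t, c t) * ∏ e, M e (h (e, false)) (h (e, true)), ?_⟩
    funext x
    let x' : T → G := fun w => x (tgt w) ⟨w, rfl⟩
    let g : (T → X → G) × (E × Bool → G) ≃ ((T × X) ⊕ (E × Bool) → G) :=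
      (Equiv.prodCongr (Equiv.curry T X G).symm (Equiv.refl _)).trans
        (Equiv.sumArrowEquivProdArrow _ _ _).symm
    have hA : ∀ y : (T → X → G) × (E × Bool → G),
        tensorOp (fun v => (N v (j v)).submatrix id (e v)) x ((ownedEquiv G own).symm (g y))
        = piOp (fun t => C.recover ((j (tgt t)).1 ⟨t, rfl⟩)) x' y.1 * if y.2 = h then 1 else 0 := by
      intro y
      rw [tensorOp_apply]
      simp only [Matrix.submatrix_apply, N, Matrix.of_apply, id, Finset.prod_mul_distrib]
      congr 1
      · simp only [piOp_apply]
        rw [← (Equiv.sigmaFiberEquiv tgt).prod_comp, Fintype.prod_sigma]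
        refine Finset.prod_congr rfl fun v _ => Finset.prod_congr rfl fun w _ => ?_
        obtain ⟨w, rfl⟩ := w
        rfl
      · by_cases hy : y.2 = h
        · rw [if_pos hy]
          refine Finset.prod_eq_one fun v _ => if_pos ?_
          funext ⟨q, hq⟩
          subst hq
          exact congrFun hy q
        · rw [if_neg hy]
          obtain ⟨q, hq⟩ := Function.ne_iff.1 hy
          refine Finset.prod_eq_zero (Finset.mem_univ (own (Sum.inr q))) (if_neg fun h' => hq ?_)
          exact congrFun h' ⟨q, rfl⟩
    have hΦ' : ∀ y, Φ ((ownedEquiv G own).symm (g y)) = (piOp B *ᵥ C.encodeAll ψ)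
        (Function.uncurry y.1) * ∏ e, M e (y.2 (e, false)) (y.2 (e, true)) := by
      intro y
      exact congrFun hΦ (g y)
    simp only [Matrix.mulVec, dotProduct]
    rw [← (ownedEquiv G own).symm.sum_comp, ← g.sum_comp]
    simp only [hA, hΦ', piOp_mulVec_encodeAll]
    rw [Fintype.sum_prod_type]
    have h5 : ∀ y : T → X → G, ∑ k : E × Bool → G,
        (piOp (fun t => C.recover ((j (tgt t)).1 ⟨t, rfl⟩)) x' y * if k = h then 1 else 0) *
        (((piOp fun t => piOp fun i => B (t, i)) *ᵥ (piOp (fun _ : T => C.enc) *ᵥ ψ)) y *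
          ∏ e, M e (k (e, false)) (k (e, true)))
        = (piOp (fun t => C.recover ((j (tgt t)).1 ⟨t, rfl⟩)) x' y *
          ((piOp fun t => piOp fun i => B (t, i)) *ᵥ (piOp (fun _ : T => C.enc) *ᵥ ψ)) y) *
          ∏ e, M e (h (e, false)) (h (e, true)) := by
      intro y
      rw [Finset.sum_eq_single h]
      · simp only [if_true]
        ring
      · intro b _ hb
        simp [hb]
      · simp
    simp only [h5]
    rw [← Finset.sum_mul]
    have h6 : ∑ y, piOp (fun t => C.recover ((j (tgt t)).1 ⟨t, rfl⟩)) x' y *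
          ((piOp fun t => piOp fun i => B (t, i)) *ᵥ (piOp (fun _ : T => C.enc) *ᵥ ψ)) y
        = (∏ t, c t) * ψ x' := by
      change (piOp (fun t => C.recover ((j (tgt t)).1 ⟨t, rfl⟩)) *ᵥ
        ((piOp fun t => piOp fun i => B (t, i)) *ᵥ (piOp (fun _ : T => C.enc) *ᵥ ψ))) x' = _
      rw [Matrix.mulVec_mulVec, Matrix.mulVec_mulVec, piOp_mul, piOp_mul]
      have h7 : (fun t => C.recover ((j (tgt t)).1 ⟨t, rfl⟩) * (piOp fun i => B (t, i)) * C.enc)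
          = fun t => c t • 1 := funext hc
      rw [h7, piOp_smul, piOp_one, Matrix.smul_mulVec, Matrix.one_mulVec]
      rfl
    rw [h6]
    simp only [Pi.smul_apply, smul_eq_mul, partyState]
    simp only [x']
    ring

/-- A state `ψ` of the parties in the range of `tgt` is prepared by the party `v₀`, encoded, and
sent along edge-disjoint routes. -/
theorem OwnedDistills.network [AddCommGroup G] (v₀ : P) (own : E × Bool → P) (tgt : T → P)
    (C : QuantumCode X G) (ψ : (T → G) → ℂ) (hψ : ∑ x, star (ψ x) * ψ x = 1)
    (r : T × X → List (E × Bool)) (hr : ∀ z, IsRoute own v₀ (r z) (tgt z.1))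
    (hnodup : ∀ z, ((r z).map Prod.fst).Nodup)
    (hdisj : ∀ z z', z ≠ z' → ((r z).map Prod.fst).Disjoint ((r z').map Prod.fst)) :
    OwnedDistills (partyState tgt ψ) own
      {Φ | ∃ M : E → Matrix G G ℂ,
        (∀ t, C.Corrects {i | ¬ ∀ e ∈ (r (t, i)).map Prod.fst, IsScalarOp (M e)}) ∧
        Φ = fun y => ∏ e, M e (y (e, false)) (y (e, true))} := by
  refine OwnedDistills.prepare v₀ (C.encodeAll ψ) (by rw [C.sum_star_mul_encodeAll, hψ])
    (OwnedDistills.transport (C.encodeAll ψ) (fun z => tgt z.1)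
      {F | ∀ t, C.Corrects {i | (t, i) ∈ F}} ?_ ?_ _ _ r rfl hr hnodup hdisj) ?_
  · intro s hs t hts w
    exact (hs w).mono fun i hi => hts hi
  · intro own' hown'
    exact OwnedDistills.decode own' tgt hown' C ψ
  · rintro _ ⟨M, hM, rfl⟩
    refine ⟨fun _ => 1, M, fun t => (hM t).mono fun i hi => ?_, ?_⟩
    · exact fun h => hi ⟨⟨1, by simp⟩, h⟩
    · funext y
      rw [dataPairState, piOp_one, Matrix.one_mulVec]
      rfl

end Protocol

theorem exists_isLOCC {P : Type u} [Fintype P] [DecidableEq P] {O : P → Type u}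
    [∀ v, Fintype (O v)] [∀ v, DecidableEq (O v)] [∀ v, Nonempty (O v)] (I : P → Type u)
    [∀ v, Fintype (I v)] [∀ v, DecidableEq (I v)] [∀ v, Nonempty (I v)] :
    ∃ Λ : Matrix (∀ v, I v) (∀ v, I v) ℂ → Matrix (∀ v, O v) (∀ v, O v) ℂ, IsLOCC I Λ := by
  have h : Distills (0 : (∀ v, O v) → ℂ) I ∅ := by
    refine Distills.parallel (J := I) (fun v j => Matrix.single (Classical.arbitrary (O v)) j 1)
      (fun v => ?_) (by simp)
    simp only [Matrix.conjTranspose_single, star_one, Matrix.single_mul_single_same, mul_one]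
    ext a b
    simp only [Matrix.sum_apply, Matrix.single_apply, Matrix.one_apply]
    by_cases hab : a = b
    · subst hab
      simp
    · rw [if_neg hab]
      refine Finset.sum_eq_zero fun j _ => if_neg ?_
      rintro ⟨rfl, rfl⟩
      exact hab rfl
  obtain ⟨Λ, hΛ, -⟩ := h
  exact ⟨Λ, hΛ⟩

/-! ### Edge-disjoint short paths -/

section Graph

variable {V : Type u}

theorem connected_deleteEdges_of_card_lt {G : SimpleGraph V} (F : Finset (Sym2 V))
    (hF : (F : Set (Sym2 V)) ⊆ G.edgeSet) (h : F.card < edgeConnectivity G) :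
    (G.deleteEdges (F : Set (Sym2 V))).Connected := by
  by_contra hc
  have h1 : edgeConnectivity G ≤ F.card := Nat.sInf_le ⟨F, hF, rfl, hc⟩
  omega

theorem SimpleGraph.Connected.exists_dist_eq {H : SimpleGraph V} (hH : H.Connected) (u v : V)
    {k : ℕ} (hk : k ≤ H.dist u v) : ∃ x, H.dist u x = k := by
  obtain ⟨p, hp⟩ := hH.exists_walk_length_eq_dist u v
  refine ⟨p.getVert k, le_antisymm ?_ ?_⟩
  · refine (SimpleGraph.dist_le (p.take k)).trans ?_
    rw [SimpleGraph.Walk.take_length]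
    exact min_le_left _ _
  · have h1 := hH.dist_triangle (u := u) (v := p.getVert k) (w := v)
    have h2 := SimpleGraph.dist_le (p.drop k)
    rw [SimpleGraph.Walk.drop_length] at h2
    omega

/-- The diameter of a graph of large minimum degree is bounded. -/
theorem SimpleGraph.Connected.dist_mul_le [Fintype V] {H : SimpleGraph V} [DecidableRel H.Adj]
    (hH : H.Connected) (D : ℕ) (hD : ∀ v, D ≤ H.degree v) (u v : V) :
    (H.dist u v / 3 + 1) * D ≤ Fintype.card V := by
  classical
  have h : ∀ i : Fin (H.dist u v / 3 + 1), ∃ x, H.dist u x = 3 * i := fun i =>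
    hH.exists_dist_eq u v (by omega)
  choose x hx using h
  have hdisj : ((Finset.univ : Finset (Fin (H.dist u v / 3 + 1))) : Set _).PairwiseDisjoint
      (fun i => H.neighborFinset (x i)) := by
    have key : ∀ i j : Fin (H.dist u v / 3 + 1), i < j →
        Disjoint (H.neighborFinset (x i)) (H.neighborFinset (x j)) := by
      intro i j hij
      rw [Finset.disjoint_left]
      intro y hy hy'
      rw [SimpleGraph.mem_neighborFinset] at hy hy'
      have h1 := hH.dist_triangle (u := u) (v := x i) (w := x j)
      have h2 := hH.dist_triangle (u := x i) (v := y) (w := x j)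
      rw [SimpleGraph.dist_eq_one_iff_adj.2 hy, SimpleGraph.dist_eq_one_iff_adj.2 hy'.symm] at h2
      rw [hx, hx] at h1
      have : (i : ℕ) < j := hij
      omega
    intro i _ j _ hij
    rcases lt_or_gt_of_ne hij with h | h
    · exact key i j h
    · exact (key j i h).symm
  calc (H.dist u v / 3 + 1) * D
      = ∑ _i : Fin (H.dist u v / 3 + 1), D := by simp
    _ ≤ ∑ i : Fin (H.dist u v / 3 + 1), (H.neighborFinset (x i)).card :=
        Finset.sum_le_sum fun i _ => by
          rw [SimpleGraph.card_neighborFinset_eq_degree]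
          exact hD _
    _ = (Finset.univ.biUnion fun i => H.neighborFinset (x i)).card :=
        (Finset.card_biUnion hdisj).symm
    _ ≤ Fintype.card V := Finset.card_le_univ _

open Classical in
theorem degree_le_degree_deleteEdges_add [Fintype V] (G : SimpleGraph V) (F : Finset (Sym2 V))
    (v : V) : G.degree v ≤ (G.deleteEdges (F : Set (Sym2 V))).degree v + F.card := by
  have h : G.neighborFinset v ⊆ (G.deleteEdges (F : Set (Sym2 V))).neighborFinset v ∪
      Finset.univ.filter fun w => s(v, w) ∈ F := by
    intro w hw
    rw [SimpleGraph.mem_neighborFinset] at hw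
    simp only [Finset.mem_union, SimpleGraph.mem_neighborFinset, SimpleGraph.deleteEdges_adj,
      Finset.mem_filter, Finset.mem_univ, true_and, Finset.mem_coe]
    tauto
  have h2 : (Finset.univ.filter fun w => s(v, w) ∈ F).card ≤ F.card := by
    refine Finset.card_le_card_of_injOn (fun w => s(v, w)) ?_ ?_
    · intro w hw
      simpa using hw
    · intro w _ w' _ h
      exact Sym2.congr_right.1 h
  rw [← SimpleGraph.card_neighborFinset_eq_degree, ← SimpleGraph.card_neighborFinset_eq_degree]
  exact (Finset.card_le_card h).trans ((Finset.card_union_le _ _).trans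
    (Nat.add_le_add_left h2 _))

open Classical in
/-- In a graph of large minimum degree and edge-connectivity there are many edge-disjoint short
paths with given end points. -/
theorem exists_edgeDisjoint_paths [Fintype V] {G : SimpleGraph V} (hG : G.Connected) {c : ℝ}
    (hc : 0 < c) {L : ℕ} (hL : 6 / c < L + 1) {Z : Type*} [Fintype Z] (v₀ : V) (tgt : Z → V)
    (hdeg : c * (Fintype.card V : ℝ) ≤ (minDeg G : ℝ))
    (hZ : (Fintype.card Z * L : ℕ) ≤ c / 2 * (Fintype.card V : ℝ))
    (hconn : Fintype.card Z * L < edgeConnectivity G) :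
    ∃ p : ∀ z, G.Walk v₀ (tgt z), (∀ z, (p z).IsPath ∧ (p z).length ≤ L) ∧
      ∀ z z', z ≠ z' → (p z).edges.Disjoint (p z').edges := by
  have key : ∀ A : Finset Z, ∃ p : ∀ z, G.Walk v₀ (tgt z),
      (∀ z ∈ A, (p z).IsPath ∧ (p z).length ≤ L) ∧
      ∀ z ∈ A, ∀ z' ∈ A, z ≠ z' → (p z).edges.Disjoint (p z').edges := by
    intro A
    induction A using Finset.induction_on with
    | empty => exact ⟨fun z => Classical.choice (hG.preconnected v₀ (tgt z)), by simp, by simp⟩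
    | insert a A ha ih =>
      obtain ⟨p, hp, hdisj⟩ := ih
      let F : Finset (Sym2 V) := A.biUnion fun z => (p z).edges.toFinset
      have hFcard : F.card ≤ Fintype.card Z * L := by
        calc F.card ≤ ∑ z ∈ A, (p z).edges.toFinset.card := Finset.card_biUnion_le
          _ ≤ ∑ z ∈ A, L := Finset.sum_le_sum fun z hz => by
              refine (List.toFinset_card_le _).trans ?_
              rw [SimpleGraph.Walk.length_edges]
              exact (hp z hz).2
          _ = A.card * L := by simp
          _ ≤ Fintype.card Z * L := Nat.mul_le_mul_right _ (Finset.card_le_univ A)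
      have hFsub : (F : Set (Sym2 V)) ⊆ G.edgeSet := by
        intro e he
        simp only [F, Finset.coe_biUnion, Set.mem_iUnion, Finset.mem_coe, List.mem_toFinset] at he
        obtain ⟨z, -, he⟩ := he
        exact (p z).edges_subset_edgeSet he
      let H := G.deleteEdges (F : Set (Sym2 V))
      have hH : H.Connected := connected_deleteEdges_of_card_lt F hFsub (hFcard.trans_lt hconn)
      have hHdeg : ∀ v, minDeg G - F.card ≤ H.degree v := by
        intro v
        have h1 := degree_le_degree_deleteEdges_add G F v
        have h2 : minDeg G ≤ G.degree v := G.minDegree_le_degree v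
        have h3 : G.degree v ≤ H.degree v + F.card := h1
        omega
      have hdist : H.dist v₀ (tgt a) ≤ L := by
        have h1 := hH.dist_mul_le _ hHdeg v₀ (tgt a)
        have hN : (0 : ℝ) < Fintype.card V := by
          have : Nonempty V := ⟨v₀⟩
          exact_mod_cast Fintype.card_pos
        have h2 : c / 2 * (Fintype.card V : ℝ) ≤ ((minDeg G - F.card : ℕ) : ℝ) := by
          have h3 : (F.card : ℝ) ≤ c / 2 * (Fintype.card V : ℝ) :=
            le_trans (by exact_mod_cast hFcard) hZ
          have h4 : ((minDeg G : ℝ) - F.card) ≤ ((minDeg G - F.card : ℕ) : ℝ) := by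
            rw [sub_le_iff_le_add]
            exact_mod_cast (by omega : minDeg G ≤ minDeg G - F.card + F.card)
          linarith
        have h5 : ((H.dist v₀ (tgt a) / 3 + 1 : ℕ) : ℝ) * (c / 2 * (Fintype.card V : ℝ))
            ≤ Fintype.card V := by
          refine le_trans (mul_le_mul_of_nonneg_left h2 (by positivity)) ?_
          exact_mod_cast h1
        have h6 : ((H.dist v₀ (tgt a) / 3 + 1 : ℕ) : ℝ) * (c / 2) ≤ 1 := by
          rw [← mul_assoc] at h5
          exact le_of_mul_le_mul_right (by linarith) hN
        have h7 : ((H.dist v₀ (tgt a) / 3 + 1 : ℕ) : ℝ) ≤ 2 / c := by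
          rw [le_div_iff₀ hc]
          linarith
        have h8 : (H.dist v₀ (tgt a) : ℝ) ≤ 3 * ((H.dist v₀ (tgt a) / 3 + 1 : ℕ) : ℝ) := by
          exact_mod_cast (by omega : H.dist v₀ (tgt a) ≤ 3 * (H.dist v₀ (tgt a) / 3 + 1))
        have h9 : (H.dist v₀ (tgt a) : ℝ) < L + 1 := by
          have : 3 * (2 / c) = 6 / c := by ring
          linarith
        have : H.dist v₀ (tgt a) < L + 1 := by exact_mod_cast h9
        omega
      obtain ⟨q, hq, hqlen⟩ := hH.exists_path_of_dist v₀ (tgt a)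
      have hle : H ≤ G := SimpleGraph.deleteEdges_le _
      have hqe : ∀ z ∈ A, (q.mapLe hle).edges.Disjoint (p z).edges := by
        intro z hz e he he'
        rw [SimpleGraph.Walk.edges_mapLe_eq_edges] at he
        have h1 := q.edges_subset_edgeSet he
        rw [SimpleGraph.edgeSet_deleteEdges] at h1
        refine h1.2 ?_
        simp only [F, Finset.coe_biUnion, Set.mem_iUnion, Finset.mem_coe, List.mem_toFinset]
        exact ⟨z, hz, he'⟩
      refine ⟨Function.update p a (q.mapLe hle), ?_, ?_⟩
      · intro z hz
        by_cases hza : z = a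
        · subst hza
          rw [Function.update_self]
          refine ⟨hq.mapLe hle, ?_⟩
          rw [SimpleGraph.Walk.mapLe, SimpleGraph.Walk.length_map]
          exact hqlen.trans_le hdist
        · rw [Function.update_of_ne hza]
          exact hp z (Finset.mem_of_mem_insert_of_ne hz hza)
      · intro z hz z' hz' hne
        by_cases hza : z = a
        · subst hza
          rw [Function.update_self, Function.update_of_ne hne.symm]
          exact hqe z' (Finset.mem_of_mem_insert_of_ne hz' hne.symm)
        · by_cases hza' : z' = a
          · subst hza'
            rw [Function.update_self, Function.update_of_ne hne]
            exact (hqe z (Finset.mem_of_mem_insert_of_ne hz hne)).symm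
          · rw [Function.update_of_ne hza, Function.update_of_ne hza']
            exact hdisj z (Finset.mem_of_mem_insert_of_ne hz hza) z'
              (Finset.mem_of_mem_insert_of_ne hz' hza') hne
  obtain ⟨p, h1, h2⟩ := key Finset.univ
  exact ⟨p, fun z => h1 z (Finset.mem_univ z),
    fun z z' => h2 z (Finset.mem_univ z) z' (Finset.mem_univ _)⟩

/-- The owner of one half of an edge, in the orientation of `edgeIdx`. -/
noncomputable def halfEdgeOwner (G : SimpleGraph V) (q : G.edgeSet × Bool) : V :=
  cond q.2 (Quot.out q.1.1).2 (Quot.out q.1.1).1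

theorem SimpleGraph.Walk.exists_isRoute {G : SimpleGraph V} {u w : V} (p : G.Walk u w) :
    ∃ l : List (G.edgeSet × Bool), IsRoute (halfEdgeOwner G) u l w ∧
      (l.map Prod.fst).map Subtype.val = p.edges := by
  induction p with
  | nil => exact ⟨[], rfl, rfl⟩
  | @cons u v w h p ih =>
    obtain ⟨l, hl, hl'⟩ := ih
    let e : G.edgeSet := ⟨s(u, v), h⟩
    have he : s((Quot.out e.1).1, (Quot.out e.1).2) = s(u, v) := Quot.out_eq e.1
    rcases Sym2.eq_iff.1 he with ⟨h1, h2⟩ | ⟨h1, h2⟩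
    · refine ⟨(e, false) :: l, ⟨h1, ?_⟩, by simp [hl', e]⟩
      have : halfEdgeOwner G (e, !false) = v := h2
      rw [this]
      exact hl
    · refine ⟨(e, true) :: l, ⟨h2, ?_⟩, by simp [hl', e]⟩
      have : halfEdgeOwner G (e, !true) = v := h1
      rw [this]
      exact hl

end Graph

/-! ### Fidelity with pure states -/

section Fidelity

variable {m : Type u} [Fintype m] [DecidableEq m]

theorem star_dotProduct_self_eq (v : m → ℂ) : star v ⬝ᵥ v = ((∑ i, ‖v i‖ ^ 2 : ℝ) : ℂ) := by
  rw [dotProduct, Complex.ofReal_sum]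
  refine Finset.sum_congr rfl fun i _ => ?_
  rw [Pi.star_apply, ← Complex.normSq_eq_norm_sq, Complex.normSq_eq_conj_mul_self]
  rfl

theorem vecMulVec_mul_vecMulVec_star (v : m → ℂ) :
    Matrix.vecMulVec v (star v) * Matrix.vecMulVec v (star v)
      = (star v ⬝ᵥ v) • Matrix.vecMulVec v (star v) := by
  ext i j
  simp only [Matrix.mul_apply, Matrix.vecMulVec_apply, Matrix.smul_apply, dotProduct,
    smul_eq_mul, Finset.sum_mul]
  exact Finset.sum_congr rfl fun k _ => by ring

theorem trace_sqrt_vecMulVec_star (v : m → ℂ) :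
    (CFC.sqrt (Matrix.vecMulVec v (star v))).trace = (Real.sqrt (∑ i, ‖v i‖ ^ 2) : ℂ) := by
  set t := Real.sqrt (∑ i, ‖v i‖ ^ 2) with ht
  have h0 : 0 ≤ ∑ i, ‖v i‖ ^ 2 := Finset.sum_nonneg fun i _ => by positivity
  have htt : t * t = ∑ i, ‖v i‖ ^ 2 := Real.mul_self_sqrt h0
  have hvv : star v ⬝ᵥ v = (t : ℂ) * t := by
    rw [star_dotProduct_self_eq, ← htt]
    push_cast
    ring
  have hpsd := Matrix.posSemidef_vecMulVec_self_star v
  by_cases hz : t = 0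
  · have hv : v = 0 := by
      rw [hz, mul_zero] at htt
      funext i
      have := (Finset.sum_eq_zero_iff_of_nonneg fun i _ => by positivity).1 htt.symm i
        (Finset.mem_univ i)
      simpa using this
    rw [hz, hv]
    simp
  · have hzc : (t : ℂ) ≠ 0 := by exact_mod_cast hz
    have hsqrt : CFC.sqrt (Matrix.vecMulVec v (star v)) =
        ((t⁻¹ : ℝ) : ℂ) • Matrix.vecMulVec v (star v) := by
      refine CFC.sqrt_unique ?_ ?_
      · rw [smul_mul_smul_comm, vecMulVec_mul_vecMulVec_star, hvv, smul_smul]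
        push_cast
        have : (t : ℂ)⁻¹ * (t : ℂ)⁻¹ * (t * t) = 1 := by field_simp
        rw [this, one_smul]
      · rw [Matrix.nonneg_iff_posSemidef]
        refine hpsd.smul ?_
        have : (0 : ℝ) ≤ t⁻¹ := inv_nonneg.2 (Real.sqrt_nonneg _)
        exact_mod_cast this
    rw [hsqrt, Matrix.trace_smul, Matrix.trace_vecMulVec, dotProduct_comm, hvv]
    push_cast
    rw [smul_eq_mul]
    field_simp

theorem fidelity_vecMulVec {ρ : Matrix m m ℂ} (hρ : ρ.PosSemidef) (φ : m → ℂ) :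
    fidelity ρ (Matrix.vecMulVec φ (star φ)) = (star φ ⬝ᵥ ρ *ᵥ φ).re := by
  have hs : (CFC.sqrt ρ)ᴴ = CFC.sqrt ρ :=
    (Matrix.nonneg_iff_posSemidef.1 (CFC.sqrt_nonneg ρ)).1
  have hss : CFC.sqrt ρ * CFC.sqrt ρ = ρ :=
    CFC.sqrt_mul_sqrt_self ρ (Matrix.nonneg_iff_posSemidef.2 hρ)
  have h1 : CFC.sqrt ρ * Matrix.vecMulVec φ (star φ) * CFC.sqrt ρ
      = Matrix.vecMulVec (CFC.sqrt ρ *ᵥ φ) (star (CFC.sqrt ρ *ᵥ φ)) := by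
    rw [← Matrix.conj_vecMulVec_star, hs]
  rw [fidelity, h1, trace_sqrt_vecMulVec_star, Complex.ofReal_re,
    Real.sq_sqrt (Finset.sum_nonneg fun i _ => by positivity)]
  have h2 := star_dotProduct_self_eq (CFC.sqrt ρ *ᵥ φ)
  rw [Matrix.star_mulVec, Matrix.dotProduct_mulVec, Matrix.vecMul_vecMul, hs, hss,
    ← Matrix.dotProduct_mulVec] at h2
  rw [h2, Complex.ofReal_re]

theorem re_dotProduct_mulVec_le_trace {ρ : Matrix m m ℂ} (hρ : ρ.PosSemidef) (φ : m → ℂ)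
    (hφ : star φ ⬝ᵥ φ = 1) : (star φ ⬝ᵥ ρ *ᵥ φ).re ≤ ρ.trace.re := by
  let R : Matrix m m ℂ := 1 - Matrix.vecMulVec φ (star φ)
  have hRH : Rᴴ = R := by
    simp only [R, Matrix.conjTranspose_sub, Matrix.conjTranspose_one]
    rw [(Matrix.posSemidef_vecMulVec_self_star φ).1]
  have hRR : R * R = R := by
    simp only [R, mul_sub, sub_mul, one_mul, mul_one, vecMulVec_mul_vecMulVec_star, hφ, one_smul]
    abel
  have h1 := (hρ.mul_mul_conjTranspose_same R).trace_nonneg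
  rw [Matrix.trace_mul_comm, ← Matrix.mul_assoc, hRH, hRR] at h1
  simp only [R, sub_mul, one_mul, Matrix.trace_sub] at h1
  rw [Matrix.vecMulVec_mul, Matrix.trace_vecMulVec, dotProduct_comm,
    ← Matrix.dotProduct_mulVec] at h1
  have h2 := (Complex.le_def.1 h1).1
  simp only [Complex.zero_re, Complex.sub_re] at h2
  linarith

/-- Bounds for the fidelity of the image of a mixture under a channel with Kraus operators `K`
which maps some of the components to the pure state `φ`. -/
theorem fidelity_channel_mixture {n : Type*} [Fintype n] [DecidableEq n] {ι : Type*} [Fintype ι]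
    (K : ι → Matrix m n ℂ) (hK : ∑ i, (K i)ᴴ * K i = 1) {B : Type*} [Fintype B] (w : B → ℝ)
    (hw : ∀ b, 0 ≤ w b) (hw1 : ∑ b, w b = 1) (Φ : B → n → ℂ) (hΦ : ∀ b, star (Φ b) ⬝ᵥ Φ b = 1)
    (φ : m → ℂ) (hφ : star φ ⬝ᵥ φ = 1) (good : Finset B)
    (hgood : ∀ b ∈ good, ∃ c : ℂ, ∑ i, K i * Matrix.vecMulVec (Φ b) (star (Φ b)) * (K i)ᴴ
      = c • Matrix.vecMulVec φ (star φ)) :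
    ∑ b ∈ good, w b ≤ fidelity (∑ i, K i * (∑ b, (w b : ℂ) • Matrix.vecMulVec (Φ b) (star (Φ b))) *
        (K i)ᴴ) (Matrix.vecMulVec φ (star φ)) ∧
      fidelity (∑ i, K i * (∑ b, (w b : ℂ) • Matrix.vecMulVec (Φ b) (star (Φ b))) *
        (K i)ᴴ) (Matrix.vecMulVec φ (star φ)) ≤ 1 := by
  let ρ : B → Matrix m m ℂ := fun b => ∑ i, K i * Matrix.vecMulVec (Φ b) (star (Φ b)) * (K i)ᴴ
  have hρ : ∀ b, (ρ b).PosSemidef := fun b => Matrix.posSemidef_sum _ fun i _ =>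
    (Matrix.posSemidef_vecMulVec_self_star (Φ b)).mul_mul_conjTranspose_same (K i)
  have hρtr : ∀ b, (ρ b).trace = 1 := by
    intro b
    have h1 : (ρ b).trace
        = ((∑ i, (K i)ᴴ * K i) * Matrix.vecMulVec (Φ b) (star (Φ b))).trace := by
      rw [Matrix.sum_mul, Matrix.trace_sum, Matrix.trace_sum]
      refine Finset.sum_congr rfl fun i _ => ?_
      rw [Matrix.trace_mul_comm, Matrix.mul_assoc]
    rw [h1, hK, one_mul, Matrix.trace_vecMulVec, dotProduct_comm, hΦ]
  have hsum : ∑ i, K i * (∑ b, (w b : ℂ) • Matrix.vecMulVec (Φ b) (star (Φ b))) * (K i)ᴴ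
      = ∑ b, (w b : ℂ) • ρ b := by
    simp only [ρ, Matrix.mul_sum, Matrix.sum_mul, Finset.smul_sum, Matrix.mul_smul,
      Matrix.smul_mul]
    exact Finset.sum_comm
  have hwc : ∀ b, (0 : ℂ) ≤ w b := fun b => by exact_mod_cast hw b
  have hpsd : (∑ b, (w b : ℂ) • ρ b).PosSemidef :=
    Matrix.posSemidef_sum _ fun b _ => (hρ b).smul (hwc b)
  rw [hsum, fidelity_vecMulVec hpsd]
  constructor
  · have h1 : (star φ ⬝ᵥ (∑ b, (w b : ℂ) • ρ b) *ᵥ φ).re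
        = ∑ b, w b * (star φ ⬝ᵥ ρ b *ᵥ φ).re := by
      rw [Matrix.sum_mulVec, dotProduct_sum, Complex.re_sum]
      refine Finset.sum_congr rfl fun b _ => ?_
      rw [Matrix.smul_mulVec, dotProduct_smul, smul_eq_mul, Complex.re_ofReal_mul]
    have h2 : ∀ b ∈ good, (star φ ⬝ᵥ ρ b *ᵥ φ).re = 1 := by
      intro b hb
      obtain ⟨c, hc⟩ := hgood b hb
      have hc' : ρ b = c • Matrix.vecMulVec φ (star φ) := hc
      have hc1 : c = 1 := by
        have := hρtr b
        rwa [hc', Matrix.trace_smul, Matrix.trace_vecMulVec, dotProduct_comm, hφ, smul_eq_mul,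
          mul_one] at this
      rw [hc', hc1, one_smul, Matrix.dotProduct_mulVec, Matrix.vecMul_vecMulVec, hφ]
      simp [hφ]
    rw [h1]
    calc ∑ b ∈ good, w b = ∑ b ∈ good, w b * (star φ ⬝ᵥ ρ b *ᵥ φ).re :=
          Finset.sum_congr rfl fun b hb => by rw [h2 b hb, mul_one]
      _ ≤ _ := Finset.sum_le_sum_of_subset_of_nonneg (Finset.subset_univ _) fun b _ _ =>
          mul_nonneg (hw b) ((hρ b).re_dotProduct_nonneg φ)
  · refine (re_dotProduct_mulVec_le_trace hpsd φ hφ).trans ?_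
    rw [Matrix.trace_sum]
    simp only [Matrix.trace_smul, hρtr, smul_eq_mul, mul_one]
    rw [← Complex.ofReal_sum, hw1]
    simp

end Fidelity

/-! ### Independent errors -/

section Errors

variable {E o ι : Type*} [Fintype E] [DecidableEq E] [Fintype o]

theorem sum_prod_mul_prod_eq (w x : o → ℝ) (hw : ∑ i, w i = 1) (Y : Finset E) :
    ∑ b : E → o, (∏ e, w (b e)) * ∏ e ∈ Y, x (b e) = (∑ i, w i * x i) ^ Y.card := by
  have h1 : ∀ b : E → o, (∏ e, w (b e)) * ∏ e ∈ Y, x (b e)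
      = ∏ e, w (b e) * if e ∈ Y then x (b e) else 1 := by
    intro b
    rw [Finset.prod_mul_distrib, Finset.prod_ite_mem, Finset.univ_inter]
  simp only [h1]
  rw [← Fintype.prod_sum (fun e i => w i * if e ∈ Y then x i else 1)]
  have h2 : ∀ e, (∑ i, w i * if e ∈ Y then x i else 1) = if e ∈ Y then ∑ i, w i * x i else 1 := by
    intro e
    split_ifs
    · rfl
    · simp [hw]
  simp only [h2]
  rw [Finset.prod_ite_mem, Finset.univ_inter, Finset.prod_const]

theorem sum_prod_mul_prod_sum_eq [DecidableEq ι] (w x : o → ℝ) (hw : ∑ i, w i = 1)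
    (S : ι → Finset E)
    (hS : ∀ i j, i ≠ j → Disjoint (S i) (S j)) (T : Finset ι) :
    ∑ b : E → o, (∏ e, w (b e)) * ∏ i ∈ T, ∑ e ∈ S i, x (b e)
      = ∏ i ∈ T, (((S i).card : ℝ) * ∑ i, w i * x i) := by
  have h1 : ∀ b : E → o, (∏ e, w (b e)) * ∏ i ∈ T, ∑ e ∈ S i, x (b e)
      = ∑ f ∈ T.pi S, (∏ e, w (b e)) * ∏ i ∈ T.attach, x (b (f i.1 i.2)) := by
    intro b
    rw [Finset.prod_sum, Finset.mul_sum]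
  simp only [h1]
  rw [Finset.sum_comm]
  have h2 : ∀ f ∈ T.pi S, ∑ b : E → o, (∏ e, w (b e)) * ∏ i ∈ T.attach, x (b (f i.1 i.2))
      = (∑ i, w i * x i) ^ T.card := by
    intro f hf
    have hinj : Set.InjOn (fun i : T => f i.1 i.2) (T.attach : Set T) := by
      intro i _ j _ hij
      by_contra hne
      have h3 := Finset.mem_pi.1 hf i.1 i.2
      have h4 := Finset.mem_pi.1 hf j.1 j.2
      simp only at hij
      rw [← hij] at h4
      exact Finset.disjoint_left.1 (hS i.1 j.1 fun h => hne (Subtype.ext h)) h3 h4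
    have h5 := sum_prod_mul_prod_eq w x hw (T.attach.image fun i => f i.1 i.2)
    rw [Finset.card_image_of_injOn hinj, Finset.card_attach] at h5
    rw [← h5]
    refine Finset.sum_congr rfl fun b _ => ?_
    rw [Finset.prod_image hinj]
  rw [Finset.sum_congr rfl h2, Finset.sum_const, Finset.card_pi, Finset.prod_mul_distrib,
    Finset.prod_const, nsmul_eq_mul]
  push_cast
  rfl

/-- A union bound over families `W` of routes all of which contain an error. -/
theorem sum_prod_filter_le {T X : Type*} [Fintype T] [Fintype X] [DecidableEq T] [DecidableEq X]
    (w : o → ℝ)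
    (hw0 : ∀ i, 0 ≤ w i) (hw : ∑ i, w i = 1) (x : o → ℝ) (hx0 : ∀ i, 0 ≤ x i)
    (S : T × X → Finset E)
    (hS : ∀ i j, i ≠ j → Disjoint (S i) (S j)) (L : ℕ) (hL : ∀ i, (S i).card ≤ L)
    (W : Finset (Finset X)) (k : ℕ) (hk : ∀ A ∈ W, A.card = k) (bad : Finset (E → o))
    (hbad : ∀ b ∈ bad, ∃ t, ∃ A ∈ W, ∀ i ∈ A, ∃ e ∈ S (t, i), 1 ≤ x (b e)) :
    ∑ b ∈ bad, ∏ e, w (b e)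
      ≤ Fintype.card T * (W.card * (L * ∑ i, w i * x i) ^ k) := by
  have hq : 0 ≤ ∑ i, w i * x i := Finset.sum_nonneg fun i _ => mul_nonneg (hw0 i) (hx0 i)
  have hprod0 : ∀ b : E → o, 0 ≤ ∏ e, w (b e) := fun b => Finset.prod_nonneg fun e _ => hw0 _
  have hterm0 : ∀ (b : E → o) t, ∀ A : Finset X, 0 ≤ ∏ i ∈ A, ∑ e ∈ S (t, i), x (b e) :=
    fun b t A => Finset.prod_nonneg fun i _ => Finset.sum_nonneg fun e _ => hx0 _
  have h1 : ∀ b ∈ bad, ∏ e, w (b e)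
      ≤ ∑ t, ∑ A ∈ W, (∏ e, w (b e)) * ∏ i ∈ A, ∑ e ∈ S (t, i), x (b e) := by
    intro b hb
    obtain ⟨t, A, hA, h⟩ := hbad b hb
    have h2 : (1 : ℝ) ≤ ∏ i ∈ A, ∑ e ∈ S (t, i), x (b e) := by
      rw [← Finset.prod_const_one (s := A)]
      refine Finset.prod_le_prod (fun _ _ => zero_le_one) fun i hi => ?_
      obtain ⟨e, he, hbe⟩ := h i hi
      exact hbe.trans (Finset.single_le_sum (f := fun e => x (b e)) (fun e _ => hx0 (b e)) he)
    have h3 : ∏ e, w (b e) ≤ (∏ e, w (b e)) * ∏ i ∈ A, ∑ e ∈ S (t, i), x (b e) :=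
      le_mul_of_one_le_right (hprod0 b) h2
    refine h3.trans ?_
    refine le_trans ?_ (Finset.single_le_sum (f := fun t => ∑ A ∈ W, (∏ e, w (b e)) *
      ∏ i ∈ A, ∑ e ∈ S (t, i), x (b e)) (fun t _ => Finset.sum_nonneg fun A _ =>
        mul_nonneg (hprod0 b) (hterm0 b t A)) (Finset.mem_univ t))
    exact Finset.single_le_sum (f := fun A => (∏ e, w (b e)) * ∏ i ∈ A, ∑ e ∈ S (t, i), x (b e))
      (fun A _ => mul_nonneg (hprod0 b) (hterm0 b t A)) hA
  let f : (E → o) → T → Finset X → ℝ := fun b t A =>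
    (∏ e, w (b e)) * ∏ i ∈ A, ∑ e ∈ S (t, i), x (b e)
  have hf0 : ∀ b t A, 0 ≤ f b t A := fun b t A => mul_nonneg (hprod0 b) (hterm0 b t A)
  have h2 : ∑ b ∈ bad, ∏ e, w (b e) ≤ ∑ b ∈ bad, ∑ t, ∑ A ∈ W, f b t A := Finset.sum_le_sum h1
  have h3 : ∑ b ∈ bad, ∑ t, ∑ A ∈ W, f b t A ≤ ∑ b, ∑ t, ∑ A ∈ W, f b t A :=
    Finset.sum_le_sum_of_subset_of_nonneg (Finset.subset_univ _) fun b _ _ =>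
      Finset.sum_nonneg fun t _ => Finset.sum_nonneg fun A _ => hf0 b t A
  have h4 : ∑ b, ∑ t, ∑ A ∈ W, f b t A = ∑ t, ∑ A ∈ W, ∑ b, f b t A := by
    rw [Finset.sum_comm]
    exact Finset.sum_congr rfl fun t _ => Finset.sum_comm
  have h5 : ∀ t, ∀ A ∈ W, ∑ b, f b t A ≤ (L * ∑ i, w i * x i) ^ k := by
    intro t A hA
    have h6 := sum_prod_mul_prod_sum_eq w x hw (fun i => S (t, i))
      (fun i j hij => hS _ _ fun h => hij (congrArg Prod.snd h)) A
    rw [← hk A hA, ← Finset.prod_const]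
    refine h6.trans_le ?_
    refine Finset.prod_le_prod (fun i _ => mul_nonneg (Nat.cast_nonneg _) hq) fun i _ => ?_
    exact mul_le_mul_of_nonneg_right (Nat.cast_le.2 (hL (t, i))) hq
  have h7 : ∑ t, ∑ A ∈ W, ∑ b, f b t A ≤ ∑ _t : T, ∑ _A ∈ W, (L * ∑ i, w i * x i) ^ k :=
    Finset.sum_le_sum fun t _ => Finset.sum_le_sum fun A hA => h5 t A hA
  refine (h2.trans (h3.trans (h4.trans_le h7))).trans_eq ?_
  rw [Finset.sum_const, Finset.sum_const, nsmul_eq_mul, nsmul_eq_mul, Finset.card_univ]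

end Errors

/-! ### Isotropic network states as mixtures -/

section Network

variable {V : Type u} (G : SimpleGraph V) (d : ℕ)

theorem halfEdgeOwner_mem (q : G.edgeSet × Bool) : halfEdgeOwner G q ∈ (q.1 : Sym2 V) := by
  obtain ⟨e, _ | _⟩ := q
  · exact Sym2.out_fst_mem e.1
  · exact Sym2.out_snd_mem e.1

theorem halfEdgeOwner_false_ne_true (e : G.edgeSet) :
    halfEdgeOwner G (e, false) ≠ halfEdgeOwner G (e, true) := by
  intro h
  have he : s((Quot.out e.1).1, (Quot.out e.1).2) = e.1 := Quot.out_eq e.1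
  have h2 : s((Quot.out e.1).1, (Quot.out e.1).2) ∈ G.edgeSet := by
    rw [he]
    exact e.2
  rw [SimpleGraph.mem_edgeSet] at h2
  exact h2.ne h

/-- The halves of edges owned by `v` are the edges at `v`. -/
noncomputable def halfEdgeEquiv (v : V) :
    {q // halfEdgeOwner G q = v} ≃ G.incidenceSet v :=
  Equiv.ofBijective
    (fun q => ⟨q.1.1.1, q.1.1.2, by
      have h := halfEdgeOwner_mem G q.1
      rwa [q.2] at h⟩) <| by
  constructor
  · rintro ⟨⟨e, β⟩, h⟩ ⟨⟨e', β'⟩, h'⟩ heq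
    obtain rfl : e = e' :=
      Subtype.ext (congrArg (fun x : G.incidenceSet v => (x : Sym2 V)) heq)
    have h3 := h.trans h'.symm
    cases β <;> cases β'
    · rfl
    · exact absurd h3 (halfEdgeOwner_false_ne_true G e)
    · exact absurd h3.symm (halfEdgeOwner_false_ne_true G e)
    · rfl
  · rintro ⟨e, he, hv⟩
    have h1 : s((Quot.out e).1, (Quot.out e).2) = e := Quot.out_eq e
    have h2 : v ∈ s((Quot.out e).1, (Quot.out e).2) := by
      rw [h1]
      exact hv
    rcases Sym2.mem_iff.1 h2 with h | h
    · exact ⟨⟨(⟨e, he⟩, false), h.symm⟩, rfl⟩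
    · exact ⟨⟨(⟨e, he⟩, true), h.symm⟩, rfl⟩

/-- The labels of one party, in terms of halves of edges. -/
noncomputable def partyEquiv (v : V) :
    PartyIdx G d v ≃ ({q // halfEdgeOwner G q = v} → Fin d) :=
  Equiv.arrowCongr (halfEdgeEquiv G v).symm (Equiv.refl _)

/-- The labels of all parties, in terms of halves of edges. -/
noncomputable def netEquiv : NetIdx G d ≃ (G.edgeSet × Bool → Fin d) :=
  (Equiv.piCongrRight (partyEquiv G d)).trans (ownedEquiv (Fin d) (halfEdgeOwner G))

theorem edgeIdx_eq (x : NetIdx G d) (e : G.edgeSet) :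
    edgeIdx G d x e = (netEquiv G d x (e, false), netEquiv G d x (e, true)) := rfl

variable [Fintype V]

open Classical in
/-- The state with coefficients `M e` on the edge `e`. -/
noncomputable def edgePureState (M : G.edgeSet → Matrix (Fin d) (Fin d) ℂ) (x : NetIdx G d) : ℂ :=
  ∏ e, M e (edgeIdx G d x e).1 (edgeIdx G d x e).2

open Classical in
theorem star_dotProduct_edgePureState [i₁ : Fintype (NetIdx G d)]
    (M : G.edgeSet → Matrix (Fin d) (Fin d) ℂ)
    (hM : ∀ e, ∑ i, ∑ j, star (M e i j) * M e i j = 1) :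
    star (edgePureState G d M) ⬝ᵥ edgePureState G d M = 1 := by
  have h1 : ∀ x, star (edgePureState G d M) x * edgePureState G d M x
      = ∏ e, star (M e (netEquiv G d x (e, false)) (netEquiv G d x (e, true))) *
        M e (netEquiv G d x (e, false)) (netEquiv G d x (e, true)) := by
    intro x
    rw [Pi.star_apply, edgePureState, star_prod, ← Finset.prod_mul_distrib]
    rfl
  rw [dotProduct]
  simp only [h1]
  rw [(netEquiv G d).sum_comp (fun y => ∏ e, star (M e (y (e, false)) (y (e, true))) *
        M e (y (e, false)) (y (e, true)))]
  rw [← (Equiv.curry G.edgeSet Bool (Fin d)).symm.sum_comp]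
  have h2 := Fintype.prod_sum (fun (e : G.edgeSet) (z : Bool → Fin d) =>
    star (M e (z false) (z true)) * M e (z false) (z true))
  refine h2.symm.trans (Finset.prod_eq_one fun e _ => ?_)
  rw [← hM e, ← Fintype.sum_prod_type' (fun i j => star (M e i j) * M e i j),
    ← (Equiv.boolArrowEquivProd (Fin d)).sum_comp]
  rfl

/-- The coefficients of the pure components of an isotropic state. -/
noncomputable def componentOp : Option (Fin d × Fin d) → Matrix (Fin d) (Fin d) ℂ
  | none => ((1 / Real.sqrt d : ℝ) : ℂ) • 1
  | some ij => Matrix.single ij.1 ij.2 1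

/-- The weights of the pure components of an isotropic state. -/
noncomputable def componentWeight (p : ℝ) : Option (Fin d × Fin d) → ℝ
  | none => p
  | some _ => (1 - p) / (d : ℝ) ^ 2

theorem componentWeight_nonneg {p : ℝ} (h0 : 0 ≤ p) (h1 : p ≤ 1) (o) :
    0 ≤ componentWeight d p o := by
  cases o with
  | none => exact h0
  | some _ => exact div_nonneg (by linarith) (by positivity)

theorem sum_componentWeight [NeZero d] (p : ℝ) : ∑ o, componentWeight d p o = 1 := by
  have : (d : ℝ) ≠ 0 := by exact_mod_cast NeZero.ne d
  simp only [componentWeight, Fintype.sum_option, Finset.sum_const, Finset.card_univ,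
    Fintype.card_prod, Fintype.card_fin, nsmul_eq_mul]
  push_cast
  field_simp
  ring

theorem sum_prod_componentWeight [NeZero d] (p : ℝ) (E : Type*) [Fintype E] [DecidableEq E] :
    ∑ b : E → Option (Fin d × Fin d), ∏ e, componentWeight d p (b e) = 1 := by
  rw [← Fintype.prod_sum (fun (_ : E) o => componentWeight d p o)]
  exact Finset.prod_eq_one fun e _ => sum_componentWeight d p

theorem sum_componentWeight_mul [NeZero d] (p : ℝ) :
    ∑ o, componentWeight d p o * (if o = none then 0 else 1) = 1 - p := by
  have h := sum_componentWeight d p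
  rw [Fintype.sum_option] at h ⊢
  simp only [if_true, mul_zero, zero_add, reduceCtorEq, if_false, mul_one]
  have h2 : componentWeight d p none = p := rfl
  linarith

theorem sum_star_mul_componentOp [NeZero d] (o : Option (Fin d × Fin d)) :
    ∑ i, ∑ j, star (componentOp d o i j) * componentOp d o i j = 1 := by
  have hd : (0 : ℝ) < d := by exact_mod_cast Nat.pos_of_ne_zero (NeZero.ne d)
  cases o with
  | none =>
    have h1 : ∀ i j : Fin d, star (componentOp d none i j) * componentOp d none i j
        = if i = j then ((1 / d : ℝ) : ℂ) else 0 := by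
      intro i j
      simp only [componentOp, Matrix.smul_apply, Matrix.one_apply, smul_eq_mul]
      split_ifs
      · rw [mul_one]
        change (starRingEnd ℂ) _ * _ = _
        rw [Complex.conj_ofReal, ← Complex.ofReal_mul]
        congr 1
        rw [div_mul_div_comm, one_mul, Real.mul_self_sqrt hd.le]
      · simp
    simp only [h1, Finset.sum_ite_eq, Finset.mem_univ, if_true, Finset.sum_const,
      Finset.card_univ, Fintype.card_fin, nsmul_eq_mul]
    rw [← Complex.ofReal_natCast, ← Complex.ofReal_mul, mul_one_div_cancel hd.ne']
    simp
  | some ij =>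
    rw [Finset.sum_eq_single ij.1, Finset.sum_eq_single ij.2]
    · simp [componentOp]
    · intro j _ hj
      simp [componentOp, hj.symm]
    · simp
    · intro i _ hi
      refine Finset.sum_eq_zero fun j _ => ?_
      simp [componentOp, hi.symm]
    · simp

theorem isotropic_eq_sum (p : ℝ) (x y : Fin d × Fin d) :
    isotropic d p x y = ∑ o, (componentWeight d p o : ℂ) *
      (componentOp d o x.1 x.2 * star (componentOp d o y.1 y.2)) := by
  rw [Fintype.sum_option]
  simp only [isotropic, Matrix.add_apply, Matrix.smul_apply, smul_eq_mul, componentWeight]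
  congr 1
  · congr 1
    simp only [Matrix.vecMulVec_apply, Pi.star_apply, maxEntangledVec, componentOp,
      Matrix.smul_apply, Matrix.one_apply, smul_eq_mul, mul_ite, mul_one, mul_zero]
  · rw [← Finset.mul_sum]
    congr 1
    rw [Matrix.one_apply]
    simp only [componentOp, Matrix.single_apply]
    by_cases h : x = y
    · subst h
      rw [if_pos rfl, Finset.sum_eq_single x]
      · simp
      · intro z _ hz
        rw [if_neg, zero_mul]
        rintro ⟨h1, h2⟩
        exact hz (Prod.ext h1 h2)
      · simp
    · rw [if_neg h]
      refine (Finset.sum_eq_zero fun z _ => ?_).symm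
      by_cases h1 : z.1 = x.1 ∧ z.2 = x.2
      · rw [if_neg (c := z.1 = y.1 ∧ z.2 = y.2), star_zero, mul_zero]
        rintro ⟨h2, h3⟩
        exact h (Prod.ext (h1.1.symm.trans h2) (h1.2.symm.trans h3))
      · rw [if_neg h1, zero_mul]

open Classical in
theorem networkState_eq_sum (p : ℝ) [i₁ : Fintype G.edgeSet] [i₂ : DecidableEq G.edgeSet] :
    networkState G d p = ∑ b : G.edgeSet → Option (Fin d × Fin d),
      ((∏ e, componentWeight d p (b e) : ℝ) : ℂ) •
        Matrix.vecMulVec (edgePureState G d fun e => componentOp d (b e))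
          (star (edgePureState G d fun e => componentOp d (b e))) := by
  ext x y
  have h1 : networkState G d p x y
      = ∏ e : G.edgeSet, isotropic d p (edgeIdx G d x e) (edgeIdx G d y e) := by
    simp only [networkState, Matrix.of_apply]
    congr!
  have h2 : ∀ M x, edgePureState G d M x
      = ∏ e : G.edgeSet, M e (edgeIdx G d x e).1 (edgeIdx G d x e).2 := by
    intro M x
    simp only [edgePureState]
    congr!
  rw [h1]
  simp only [isotropic_eq_sum]
  rw [Fintype.prod_sum, Matrix.sum_apply]
  refine Finset.sum_congr rfl fun b _ => ?_
  rw [Matrix.smul_apply, Matrix.vecMulVec_apply, Finset.prod_mul_distrib, Finset.prod_mul_distrib,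
    Pi.star_apply, h2, h2, star_prod, Complex.ofReal_prod, smul_eq_mul]

end Network

/-! ### Network protocols -/

section NetworkProtocol

theorem Distills.network {P : Type u} [Fintype P] [DecidableEq P]
    {T E : Type u} [Fintype T] [DecidableEq T] [Fintype E] [DecidableEq E]
    {G : Type} [Fintype G] [DecidableEq G] {X : Type} [Fintype X] [DecidableEq X]
    [AddCommGroup G] (v₀ : P) (own : E × Bool → P) (tgt : T → P) {p : T → P → Prop}
    (hp : ∀ w v, p w v ↔ tgt w = v) [i₁ : ∀ v, Fintype ({w // p w v} → G)]
    [i₂ : ∀ v, DecidableEq ({w // p w v} → G)]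
    (C : QuantumCode X G) (ψ : (T → G) → ℂ) (hψ : ∑ x, star (ψ x) * ψ x = 1)
    (r : T × X → List (E × Bool)) (hr : ∀ z, IsRoute own v₀ (r z) (tgt z.1))
    (hnodup : ∀ z, ((r z).map Prod.fst).Nodup)
    (hdisj : ∀ z z', z ≠ z' → ((r z).map Prod.fst).Disjoint ((r z').map Prod.fst)) :
    Distills (O := fun v => {w // p w v} → G)
      (fun f => ψ fun w => f (tgt w) ⟨w, (hp w (tgt w)).2 rfl⟩)
      (fun v => {q // own q = v} → G)
      {Φ | ∃ M : E → Matrix G G ℂ,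
        (∀ t, C.Corrects {i | ¬ ∀ e ∈ (r (t, i)).map Prod.fst, IsScalarOp (M e)}) ∧
        (fun y => Φ ((ownedEquiv G own).symm y))
          = fun y => ∏ e, M e (y (e, false)) (y (e, true))} := by
  obtain rfl : p = fun w v => tgt w = v := by
    funext w v
    exact propext (hp w v)
  have h := OwnedDistills.network v₀ own tgt C ψ hψ r hr hnodup hdisj
  unfold OwnedDistills at h
  convert h
  · rfl
  · rfl

variable {α : Type u} {V V₀ : Finset α}

open Classical in
theorem exists_isNetworkLOCC_of_paths (G : SimpleGraph V) (d : ℕ) [NeZero d] (h : V₀ ⊆ V)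
    {X : Type} [Fintype X] [DecidableEq X] (C : QuantumCode X (Fin d)) (v₀ : V)
    (p : ∀ z : V₀ × X, G.Walk v₀ ⟨z.1, h z.1.2⟩) (hp : ∀ z, (p z).IsPath)
    (hdisj : ∀ z z', z ≠ z' → (p z).edges.Disjoint (p z').edges)
    (φ : (V₀ → Fin d) → ℂ) (hφ : star φ ⬝ᵥ φ = 1) :
    ∃ Λ : Matrix (NetIdx G d) (NetIdx G d) ℂ → Matrix (V₀ → Fin d) (V₀ → Fin d) ℂ,
      IsNetworkLOCC G d h Λ ∧ ∀ M : G.edgeSet → Matrix (Fin d) (Fin d) ℂ,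
        (∀ t, C.Corrects {i | ∃ e : G.edgeSet, (e : Sym2 V) ∈ (p (t, i)).edges ∧
          ¬ IsScalarOp (M e)}) →
        ∃ c : ℂ, Λ (Matrix.vecMulVec (edgePureState G d M) (star (edgePureState G d M)))
          = c • Matrix.vecMulVec φ (star φ) := by
  choose r hr hre using fun z => (p z).exists_isRoute
  have hmem : ∀ z (e : G.edgeSet), e ∈ (r z).map Prod.fst ↔ (e : Sym2 V) ∈ (p z).edges := by
    intro z e
    rw [← hre z]
    exact (List.mem_map_of_injective Subtype.val_injective).symm
  have hD := Distills.network (G := Fin d) v₀ (halfEdgeOwner G) (fun w : V₀ => (⟨w, h w.2⟩ : V))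
    (p := fun w v => (w : α) = v)
    (fun w v => ⟨fun h => Subtype.ext h, fun h => congrArg Subtype.val h⟩) C φ hφ r hr
    (fun z => List.Nodup.of_map Subtype.val (by rw [hre]; exact (hp z).isTrail.edges_nodup))
    (fun z z' hz e h1 h2 => hdisj z z' hz ((hmem z e).1 h1) ((hmem z' e).1 h2))
  have : Nonempty V := ⟨v₀⟩
  have hD' := Distills.reindex (I := PartyIdx G d) (partyEquiv G d) hD
    (S := {Φ | ∃ M : G.edgeSet → Matrix (Fin d) (Fin d) ℂ,
      (∀ t, C.Corrects {i | ∃ e : G.edgeSet, (e : Sym2 V) ∈ (p (t, i)).edges ∧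
          ¬ IsScalarOp (M e)}) ∧ Φ = edgePureState G d M}) (by
      rintro _ ⟨M, hM, rfl⟩
      refine ⟨M, fun t => (hM t).mono fun i hi => ?_, ?_⟩
      · simp only [Set.mem_ofPred_eq, not_forall] at hi
        obtain ⟨e, he, he'⟩ := hi
        exact ⟨e, (hmem _ _).1 he, he'⟩
      · funext y
        have h1 : ∀ e, edgeIdx G d ((netEquiv G d).symm y) e = (y (e, false), y (e, true)) := by
          intro e
          rw [edgeIdx_eq, Equiv.apply_symm_apply]
        change edgePureState G d M ((netEquiv G d).symm y) = _
        simp only [edgePureState, h1])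
  obtain ⟨Γ, hΓ, hΓ'⟩ := hD'
  refine ⟨fun ρ => Matrix.reindex (outEquiv h d) (outEquiv h d) (Γ ρ), ⟨Γ, hΓ, fun _ => rfl⟩, ?_⟩
  intro M hM
  obtain ⟨c, hc⟩ := hΓ' _ ⟨M, hM, rfl⟩
  refine ⟨c, ?_⟩
  change Matrix.reindex (outEquiv h d) (outEquiv h d) (Γ _) = _
  rw [hc]
  rfl

open Classical in
theorem IsNetworkLOCC.exists_kraus {G : SimpleGraph V} {d : ℕ} {h : V₀ ⊆ V}
    {Λ : Matrix (NetIdx G d) (NetIdx G d) ℂ → Matrix (V₀ → Fin d) (V₀ → Fin d) ℂ}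
    (hΛ : IsNetworkLOCC G d h Λ) :
    ∃ (ι : Type) (_ : Fintype ι) (K : ι → Matrix (V₀ → Fin d) (NetIdx G d) ℂ),
      (∀ ρ, Λ ρ = ∑ i, K i * ρ * (K i)ᴴ) ∧ ∑ i, (K i)ᴴ * K i = 1 := by
  obtain ⟨Γ, hΓ, hΓ'⟩ := hΛ
  obtain ⟨ι, hι, K, hK, hK1⟩ := hΓ.exists_kraus
  refine ⟨ι, hι, fun i => (K i).submatrix (outEquiv h d).symm id, ?_, ?_⟩
  · intro ρ
    rw [hΓ', hK]
    ext x y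
    simp [Matrix.sum_apply, Matrix.mul_apply]
  · rw [← hK1]
    refine Finset.sum_congr rfl fun i _ => ?_
    rw [Matrix.conjTranspose_submatrix, Matrix.submatrix_mul_equiv, Matrix.submatrix_id_id]

open Classical in
theorem IsNetworkLOCC.fidelity_bounds_of_mixture {G : SimpleGraph V} {d : ℕ} {h : V₀ ⊆ V}
    {Λ : Matrix (NetIdx G d) (NetIdx G d) ℂ → Matrix (V₀ → Fin d) (V₀ → Fin d) ℂ}
    (hΛ : IsNetworkLOCC G d h Λ) {B : Type*} [Fintype B] {σ : Matrix (NetIdx G d) (NetIdx G d) ℂ}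
    {w : B → ℝ} (hw : ∀ b, 0 ≤ w b) (hw1 : ∑ b, w b = 1) {Φ : B → NetIdx G d → ℂ}
    (hΦ : ∀ b, star (Φ b) ⬝ᵥ Φ b = 1)
    (hσ : σ = ∑ b, (w b : ℂ) • Matrix.vecMulVec (Φ b) (star (Φ b)))
    (φ : (V₀ → Fin d) → ℂ) (hφ : star φ ⬝ᵥ φ = 1) (good : Finset B)
    (hgood : ∀ b ∈ good, ∃ c : ℂ,
      Λ (Matrix.vecMulVec (Φ b) (star (Φ b))) = c • Matrix.vecMulVec φ (star φ)) :
    ∑ b ∈ good, w b ≤ fidelity (Λ σ) (Matrix.vecMulVec φ (star φ)) ∧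
      fidelity (Λ σ) (Matrix.vecMulVec φ (star φ)) ≤ 1 := by
  obtain ⟨ι, _, K, hK, hK1⟩ := hΛ.exists_kraus
  have hg : ∀ b ∈ good, ∃ c : ℂ, ∑ i, K i * Matrix.vecMulVec (Φ b) (star (Φ b)) * (K i)ᴴ
      = c • Matrix.vecMulVec φ (star φ) := by
    intro b hb
    obtain ⟨c, hc⟩ := hgood b hb
    exact ⟨c, (hK _).symm.trans hc⟩
  have hmain := fidelity_channel_mixture K hK1 w hw hw1 Φ hΦ φ hφ good hg
  rw [← hσ, ← hK] at hmain
  exact hmain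

open Classical in
theorem IsNetworkLOCC.fidelity_bounds {G : SimpleGraph V} {d : ℕ} [NeZero d] {h : V₀ ⊆ V}
    {Λ : Matrix (NetIdx G d) (NetIdx G d) ℂ → Matrix (V₀ → Fin d) (V₀ → Fin d) ℂ}
    (hΛ : IsNetworkLOCC G d h Λ) {p : ℝ} (h0 : 0 ≤ p) (h1 : p ≤ 1) (φ : (V₀ → Fin d) → ℂ)
    (hφ : star φ ⬝ᵥ φ = 1) (good : Finset (G.edgeSet → Option (Fin d × Fin d)))
    (hgood : ∀ b ∈ good, ∃ c : ℂ,
      Λ (Matrix.vecMulVec (edgePureState G d fun e => componentOp d (b e))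
        (star (edgePureState G d fun e => componentOp d (b e))))
        = c • Matrix.vecMulVec φ (star φ)) :
    ∑ b ∈ good, ∏ e, componentWeight d p (b e)
        ≤ fidelity (Λ (networkState G d p)) (Matrix.vecMulVec φ (star φ)) ∧
      fidelity (Λ (networkState G d p)) (Matrix.vecMulVec φ (star φ)) ≤ 1 :=
  hΛ.fidelity_bounds_of_mixture
    (fun _ => Finset.prod_nonneg fun _ _ => componentWeight_nonneg d h0 h1 _)
    (sum_prod_componentWeight d p G.edgeSet)
    (fun _ => star_dotProduct_edgePureState G d _ fun _ => sum_star_mul_componentOp d _)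
    (networkState_eq_sum G d p) φ hφ good hgood

open Classical in
theorem exists_isNetworkLOCC (G : SimpleGraph V) (d : ℕ) [NeZero d] (h : V₀ ⊆ V) :
    ∃ Λ, IsNetworkLOCC G d h Λ := by
  obtain ⟨Γ, hΓ⟩ := exists_isLOCC (O := fun v : V => OutIdx V₀ d (v : α)) (PartyIdx G d)
  exact ⟨_, Γ, hΓ, fun _ => rfl⟩

open Classical in
/-- A protocol for a network of large minimum degree and edge-connectivity. -/
theorem exists_isNetworkLOCC_fidelity_ge {G : SimpleGraph V} (hG : G.Connected) (d : ℕ) [NeZero d]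
    (h : V₀ ⊆ V) {X : Type} [Fintype X] [DecidableEq X] (C : QuantumCode X (Fin d))
    (W : Finset (Finset X)) (k : ℕ) (hWk : ∀ A ∈ W, A.card = k)
    (hW : ∀ F : Set X, (∀ A ∈ W, ¬ (A : Set X) ⊆ F) → C.Corrects F)
    {c : ℝ} (hc : 0 < c) {L : ℕ} (hL : 6 / c < L + 1)
    (hdeg : c * (V.card : ℝ) ≤ (minDeg G : ℝ))
    (hZ : (V₀.card * Fintype.card X * L : ℕ) ≤ c / 2 * (V.card : ℝ))
    (hconn : V₀.card * Fintype.card X * L < edgeConnectivity G)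
    {p : ℝ} (h0 : 0 ≤ p) (h1 : p ≤ 1) (φ : (V₀ → Fin d) → ℂ) (hφ : star φ ⬝ᵥ φ = 1) :
    ∃ Λ, IsNetworkLOCC G d h Λ ∧ 1 - V₀.card * (W.card * (L * (1 - p)) ^ k)
      ≤ fidelity (Λ (networkState G d p)) (Matrix.vecMulVec φ (star φ)) := by
  have hcard : Fintype.card (V₀ × X) = V₀.card * Fintype.card X := by simp
  have hcardV : Fintype.card V = V.card := by simp
  have v₀ : V := Classical.choice hG.nonempty
  obtain ⟨P, hP, hdisj⟩ := exists_edgeDisjoint_paths hG hc hL v₀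
    (fun z : V₀ × X => (⟨z.1, h z.1.2⟩ : V)) (by rwa [hcardV])
    (by rw [hcard, hcardV]; exact hZ) (by rwa [hcard])
  obtain ⟨Λ, hΛ, hΛ'⟩ := exists_isNetworkLOCC_of_paths G d h C v₀ P (fun z => (hP z).1) hdisj φ hφ
  refine ⟨Λ, hΛ, ?_⟩
  let S : V₀ × X → Finset G.edgeSet := fun z =>
    Finset.univ.filter fun e => (e : Sym2 V) ∈ (P z).edges
  have hS : ∀ z z', z ≠ z' → Disjoint (S z) (S z') := by
    intro z z' hz
    rw [Finset.disjoint_left]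
    intro e h1 h2
    exact hdisj z z' hz (Finset.mem_filter.1 h1).2 (Finset.mem_filter.1 h2).2
  have hSL : ∀ z, (S z).card ≤ L := by
    intro z
    refine le_trans ?_ (hP z).2
    rw [← SimpleGraph.Walk.length_edges, ← List.toFinset_card_of_nodup (hP z).1.isTrail.edges_nodup]
    refine Finset.card_le_card_of_injOn Subtype.val ?_ Subtype.val_injective.injOn
    intro e he
    simpa using (Finset.mem_filter.1 he).2
  let isBad : (G.edgeSet → Option (Fin d × Fin d)) → Prop := fun b =>
    ∃ t, ∃ A ∈ W, ∀ i ∈ A, ∃ e ∈ S (t, i), b e ≠ none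
  let bad := Finset.univ.filter isBad
  let good := Finset.univ.filter fun b => ¬ isBad b
  have hbound := (hΛ.fidelity_bounds h0 h1 φ hφ good ?_).1
  · have htot : ∑ b ∈ bad, ∏ e, componentWeight d p (b e)
        + ∑ b ∈ good, ∏ e, componentWeight d p (b e) = 1 := by
      rw [Finset.sum_filter_add_sum_filter_not]
      exact sum_prod_componentWeight d p G.edgeSet
    have hb := sum_prod_filter_le (componentWeight d p) (componentWeight_nonneg d h0 h1)
      (sum_componentWeight d p) (fun o => if o = none then 0 else 1)
      (fun o => by split_ifs <;> norm_num) S hS L hSL W k hWk bad (by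
        intro b hb
        obtain ⟨t, A, hA, hAi⟩ := (Finset.mem_filter.1 hb).2
        refine ⟨t, A, hA, fun i hi => ?_⟩
        obtain ⟨e, he, hbe⟩ := hAi i hi
        exact ⟨e, he, by rw [if_neg hbe]⟩)
    rw [sum_componentWeight_mul, Fintype.card_coe] at hb
    linarith
  · intro b hb
    refine hΛ' _ fun t => hW _ fun A hA hsub => (Finset.mem_filter.1 hb).2 ⟨t, A, hA, fun i hi => ?_⟩
    obtain ⟨e, he, hbe⟩ := hsub hi
    refine ⟨e, Finset.mem_filter.2 ⟨Finset.mem_univ e, he⟩, fun hnone => hbe ?_⟩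
    rw [hnone]
    exact ⟨_, rfl⟩

end NetworkProtocol

/-! ### Partial distillability -/

section PartialDistillability

variable {α : Type u} {V V₀ : Finset α}

open Classical in
theorem exists_isNetworkLOCC_forall_fidelity_le (G : SimpleGraph V) (d : ℕ) [NeZero d]
    (h : V₀ ⊆ V) {p : ℝ} (h0 : 0 ≤ p) (h1 : p ≤ 1) (φ : (V₀ → Fin d) → ℂ)
    (hφ : star φ ⬝ᵥ φ = 1) {ε : ℝ} (hε : 0 < ε) :
    ∃ Λ, IsNetworkLOCC G d h Λ ∧ ∀ Λ', IsNetworkLOCC G d h Λ' →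
      fidelity (Λ' (networkState G d p)) (Matrix.vecMulVec φ (star φ))
        ≤ fidelity (Λ (networkState G d p)) (Matrix.vecMulVec φ (star φ)) + ε := by
  let s : Set ℝ := {x | ∃ Λ, IsNetworkLOCC G d h Λ ∧
    x = fidelity (Λ (networkState G d p)) (Matrix.vecMulVec φ (star φ))}
  have hne : s.Nonempty := by
    obtain ⟨Λ, hΛ⟩ := exists_isNetworkLOCC G d h
    exact ⟨_, Λ, hΛ, rfl⟩
  have hbdd : BddAbove s := by
    refine ⟨1, ?_⟩
    rintro _ ⟨Λ, hΛ, rfl⟩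
    exact (hΛ.fidelity_bounds h0 h1 φ hφ ∅ (by simp)).2
  obtain ⟨_, ⟨Λ, hΛ, rfl⟩, hlt⟩ := exists_lt_of_lt_csSup hne (sub_lt_self (sSup s) hε)
  refine ⟨Λ, hΛ, fun Λ' hΛ' => ?_⟩
  have := le_csSup hbdd ⟨Λ', hΛ', rfl⟩
  linarith

theorem GraphSequence.eventually_subset_verts (S : GraphSequence α) {n : ℕ}
    (h : V₀ ⊆ S.verts n) : ∀ᶠ k in atTop, V₀ ⊆ S.verts k :=
  eventually_atTop.2 ⟨n, fun _ hk => h.trans (monotone_nat_of_le_succ S.verts_subset_succ hk)⟩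

open Classical in
/-- Protocols of arbitrarily small infidelity for all large members of the sequence. -/
theorem GraphSequence.eventually_exists_isNetworkLOCC (S : GraphSequence α) (d : ℕ) [NeZero d]
    {c : ℝ} (hc : 0 < c)
    (hdeg : ∀ᶠ n in atTop, c * ((S.verts n).card : ℝ) ≤ (minDeg (S.graph n) : ℝ))
    (hconn : Tendsto (fun n => edgeConnectivity (S.graph n)) atTop atTop)
    {L : ℕ} (hL : 6 / c < L + 1) {p : ℝ} (h0 : 0 ≤ p) (h1 : p ≤ 1) (hp : 81 * (L * (1 - p)) ≤ 1 / 2)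
    (φ : (V₀ → Fin d) → ℂ) (hφ : star φ ⬝ᵥ φ = 1) {ε : ℝ} (hε : 0 < ε) :
    ∀ᶠ n in atTop, ∀ h : V₀ ⊆ S.verts n, ∃ Λ, IsNetworkLOCC (S.graph n) d h Λ ∧
      1 - ε < fidelity (Λ (networkState (S.graph n) d p)) (Matrix.vecMulVec φ (star φ)) := by
  obtain ⟨r, hr⟩ : ∃ r : ℕ, (V₀.card : ℝ) * (1 / 2) ^ r < ε := by
    have ht : Tendsto (fun r : ℕ => (V₀.card : ℝ) * (1 / 2) ^ r) atTop (𝓝 (V₀.card * 0)) :=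
      (tendsto_pow_atTop_nhds_zero_of_lt_one (by norm_num) (by norm_num)).const_mul _
    rw [mul_zero] at ht
    exact (ht.eventually (gt_mem_nhds hε)).exists
  obtain ⟨X, _, _, C, W, hW, hWr, hC⟩ := QuantumCode.exists_concatenated (Fin d) r
  have hsmall : (V₀.card : ℝ) * (W.card * (L * (1 - p)) ^ 2 ^ r) < ε := by
    refine lt_of_le_of_lt (mul_le_mul_of_nonneg_left ?_ (Nat.cast_nonneg _)) hr
    have hx : 0 ≤ (L : ℝ) * (1 - p) := mul_nonneg (Nat.cast_nonneg _) (by linarith)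
    have hW' : (W.card : ℝ) ≤ 81 ^ 2 ^ r := by
      have : W.card ≤ 81 ^ 2 ^ r := le_trans (Nat.le_mul_of_pos_left _ (by norm_num)) hW
      exact_mod_cast this
    have h2 : (W.card : ℝ) * (L * (1 - p)) ^ 2 ^ r ≤ (81 * (L * (1 - p))) ^ 2 ^ r := by
      rw [mul_pow 81]
      exact mul_le_mul_of_nonneg_right hW' (pow_nonneg hx _)
    have h3 : (81 * (L * (1 - p))) ^ 2 ^ r ≤ ((1 : ℝ) / 2) ^ 2 ^ r :=
      pow_le_pow_left₀ (by linarith) hp _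
    have h4 : ((1 : ℝ) / 2) ^ 2 ^ r ≤ (1 / 2) ^ r :=
      pow_le_pow_of_le_one (by norm_num) (by norm_num) Nat.lt_two_pow_self.le
    exact h2.trans (h3.trans h4)
  have horder : ∀ᶠ n in atTop,
      ((V₀.card * Fintype.card X * L : ℕ) : ℝ) ≤ c / 2 * ((S.verts n).card : ℝ) :=
    ((tendsto_natCast_atTop_atTop.comp S.order_tendsto).const_mul_atTop
      (half_pos hc)).eventually_ge_atTop _
  filter_upwards [hdeg, horder, hconn.eventually_gt_atTop (V₀.card * Fintype.card X * L)]
    with n hn1 hn2 hn3 h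
  obtain ⟨Λ, hΛ, hF⟩ := exists_isNetworkLOCC_fidelity_ge (S.connected n) d h C W (2 ^ r) hWr hC hc
    hL hn1 hn2 hn3 h0 h1 φ hφ
  exact ⟨Λ, hΛ, by linarith⟩

open Classical in
theorem GraphSequence.hasPartialDistillability (S : GraphSequence α) (d : ℕ) [NeZero d]
    {c : ℝ} (hc : 0 < c)
    (hdeg : ∀ᶠ n in atTop, c * ((S.verts n).card : ℝ) ≤ (minDeg (S.graph n) : ℝ))
    (hconn : Tendsto (fun n => edgeConnectivity (S.graph n)) atTop atTop) :
    HasPartialDistillability S d := by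
  obtain ⟨L, hL⟩ : ∃ L : ℕ, 6 / c < L + 1 := ⟨_, Nat.lt_floor_add_one _⟩
  have hL0 : (0 : ℝ) < L + 1 := by positivity
  refine ⟨1 - 1 / (162 * (L + 1)), sub_lt_self _ (by positivity), ?_⟩
  rintro m V₀ - ⟨n₀, hn₀⟩ _ ⟨φ, hφ, rfl⟩
  replace hφ : star φ ⬝ᵥ φ = 1 := by
    rw [star_dotProduct_self_eq, hφ, Complex.ofReal_one]
  have hex : ∀ n p, ∃ Λ : Matrix (NetIdx (S.graph n) d) (NetIdx (S.graph n) d) ℂ →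
      Matrix (V₀ → Fin d) (V₀ → Fin d) ℂ,
      ∀ h : V₀ ⊆ S.verts n, IsNetworkLOCC (S.graph n) d h Λ ∧
        (0 ≤ p → p ≤ 1 → ∀ Λ', IsNetworkLOCC (S.graph n) d h Λ' →
          fidelity (Λ' (networkState (S.graph n) d p)) (Matrix.vecMulVec φ (star φ))
          ≤ fidelity (Λ (networkState (S.graph n) d p)) (Matrix.vecMulVec φ (star φ))
            + 1 / ((n : ℝ) + 1)) := by
    intro n p
    by_cases h : V₀ ⊆ S.verts n
    · by_cases hp : 0 ≤ p ∧ p ≤ 1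
      · obtain ⟨Λ, hΛ, hΛ'⟩ := exists_isNetworkLOCC_forall_fidelity_le (S.graph n) d h hp.1 hp.2 φ
          hφ (ε := 1 / ((n : ℝ) + 1)) Nat.one_div_pos_of_nat
        exact ⟨Λ, fun _ => ⟨hΛ, fun _ _ => hΛ'⟩⟩
      · obtain ⟨Λ, hΛ⟩ := exists_isNetworkLOCC (S.graph n) d h
        exact ⟨Λ, fun _ => ⟨hΛ, fun h0 h1 => absurd ⟨h0, h1⟩ hp⟩⟩
    · exact ⟨fun _ => 0, fun h' => absurd h' h⟩
  choose Λ hΛ using hex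
  refine ⟨Λ, fun n p h => (hΛ n p h).1, fun p h0 h1 hp => ?_⟩
  have hp' : 81 * (L * (1 - p)) ≤ 1 / 2 := by
    have h2 : (1 - p) * (162 * (L + 1)) < 1 :=
      (lt_div_iff₀ (by positivity)).1 (by linarith)
    nlinarith
  have hev := S.eventually_subset_verts hn₀
  refine tendsto_order.2 ⟨fun a ha => ?_, fun a ha => ?_⟩
  · have hε : 0 < (1 - a) / 2 := by linarith
    filter_upwards [hev, S.eventually_exists_isNetworkLOCC d hc hdeg hconn hL h0 h1 hp' φ hφ hε,
      (tendsto_one_div_add_atTop_nhds_zero_nat (𝕜 := ℝ)).eventually (gt_mem_nhds hε)]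
      with n hn1 hn2 hn3
    obtain ⟨Λ', hΛ', hF⟩ := hn2 hn1
    have := (hΛ n p hn1).2 h0 h1 Λ' hΛ'
    linarith
  · filter_upwards [hev] with n hn
    exact lt_of_le_of_lt ((hΛ n p hn).1.fidelity_bounds h0 h1 φ hφ ∅ (by simp)).2 ha

end PartialDistillability

theorem theorem6 {α : Type*} (S : GraphSequence α) (d : ℕ) (hd : 1 ≤ d)
    (hdeg : ∃ c : ℝ, 0 < c ∧
      ∀ᶠ n in Filter.atTop, c * ((S.verts n).card : ℝ) ≤ (minDeg (S.graph n) : ℝ))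
    (hconn : Filter.Tendsto (fun n => edgeConnectivity (S.graph n)) Filter.atTop Filter.atTop) :
    HasPartialDistillability S d := by
  have : NeZero d := ⟨by omega⟩
  obtain ⟨c, hc, hdeg⟩ := hdeg
  exact S.hasPartialDistillability d hc hdeg hconn
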